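/- \textbf{Setting.} A weighted digraph $G=(V,E,w)$ consists of a finite set $V$, a set $E\subseteq V\times V$ of edges without self-loops (opposite pairs of edges are allowed) and weights $w:E\to(0,\infty)$. For $a,b\in V$ let $d(a,b)\in[0,\infty]$ be the minimal total weight of a directed path from $a$ to $b$ ($\infty$ if there is none), and for $t\in\mathbb R$ let $G^t$ be the digraph on $V$ with edges $\{(a,b): a\neq b,\ d(a,b)\le t\}$. For a digraph $D$ without self-loops on $V$ let $\Omega_\bullet(D)$ be its regular path complex over $\mathbb R$: $\Omega_0(D)$ is spanned by the vertices, and for $p\ge 1$, $\Omega_p(D)$ is the space of linear combinations $x$ of allowed $p$-paths $v_0\dots v_p$ (all $(v_i,v_{i+1})$ are edges of $D$) such that $\partial_p x$ is a linear combination of allowed $(p-1)$-paths, where $\partial_p(v_0\dots v_p)=\sum_i(-1)^i\,v_0\dots\widehat{v_i}\dots v_p$ and paths with two equal consecutive vertices are set to $0$. Grounded persistent path homology (GrPPH) of $G$ is the persistent real vector space $\mathcal H_1(G)$ over the poset $\mathbb R$ given by $$\mathcal H_1(G)(t)=\frac{\ker\bigl(\partial_1:\Omega_1(G\cup G^t)\to\Omega_0(G\cup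 G^t)\bigr)}{\partial_2\,\Omega_2(G^t)}\quad(t\ge 0),\qquad \mathcal H_1(G)(t)=0\quad(t<0),$$ where $G\cup G^t$ is the digraph on $V$ with all edges of $G$ and of $G^t$, and where the structure maps are induced by inclusion of chains. A barcode is a multiset of nonempty intervals of $\mathbb R$. It is a barcode of a persistent vector space $M$ if $M\cong\bigoplus_I P(I)$, the sum being over the intervals $I$ of the multiset, where $P(I)$ is the interval module of $I$. The diagram $\mathrm{Dgm}(\mathcal B)$ of a barcode $\mathcal B$ is the multiset of pairs $(\inf I,\sup I)\in[-\infty,\infty]^2$. The bottleneck distance is $$d_B(\mathcal B,\mathcal B')=\inf_\gamma\ \sup_x\ \lVert x-\gamma(x)\rVert_\infty\in[0,\infty],$$ where $\gamma$ ranges over the multi-bijections $\mathrm{Dgm}(\mathcal B)\cup\Delta\to\mathrm{Dgm}(\mathcal B')\cup\Delta$, with $\Delta=\{(x,x):x\in\mathbb R\}$ taken with multiplicity one, and where an infinite coordinate is at distance $0$ from itself and at distance $\infty$ from every other value. The medial subdivision of $G$ replaces every edge $e=(a,b)$ by two edges $(a,v_e)$ and $(v_e,b)$ through a new vertex $v_e$,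 each of weight $w(e)/2$. The iterated medial subdivisions are $G^{(0)}=G$ and $G^{(n)}=$ the medial subdivision of $G^{(n-1)}$. \textbf{Statement.} Let $G$ be any weighted digraph. Then each $\mathcal H_1(G^{(n)})$, $n\ge 0$, has a barcode, and the sequence of these barcodes converges in bottleneck distance: there is a finite barcode $\mathcal B_\infty$ such that, whenever $\mathcal B_n$ is a barcode of $\mathcal H_1(G^{(n)})$ for every $n\ge 0$, $$\lim_{n\to\infty} d_B(\mathcal B_n,\mathcal B_\infty)=0 .$$ -/

import Mathlib

open CategoryTheory Filter Topology
open scoped ENNReal DirectSum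

noncomputable section

namespace GrPPH

/-! ## Weighted digraphs -/

/-- A finite simple digraph (no self-loops; a pair of opposite edges is allowed) with positive
real weights on its edges. -/
structure WDigraph where
  V : Type
  finite : Finite V
  graph : Digraph V
  loopless : ∀ v, ¬ graph.Adj v v
  weight : {e : V × V // graph.Adj e.1 e.2} → ℝ
  weight_pos : ∀ e, 0 < weight e

namespace WDigraph

/-- The type of edges. -/
abbrev Edge (G : WDigraph) : Type := {e : G.V × G.V // G.graph.Adj e.1 e.2}

/-- Directed trails `a ⇝ b`: sequences of consecutive forward edges. -/
inductive Trail (G : WDigraph) : G.V → G.V → Type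
  | nil (a : G.V) : Trail G a a
  | cons {a b c : G.V} (h : G.graph.Adj a b) (p : Trail G b c) : Trail G a c

/-- The length of a trail is the sum of the weights of its edges. -/
def Trail.length {G : WDigraph} : {a b : G.V} → G.Trail a b → ℝ
  | _, _, .nil _ => 0
  | _, _, .cons (a := a) (b := b) h p => G.weight ⟨(a, b), h⟩ + p.length

/-- The sequence of vertices of a trail. -/
def Trail.support {G : WDigraph} : {a b : G.V} → G.Trail a b → List G.V
  | _, _, .nil a => [a]
  | _, _, .cons (a := a) _ p => a :: p.support

/-- A path is a trail that does not repeat vertices. -/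
def Trail.IsPath {G : WDigraph} {a b : G.V} (p : G.Trail a b) : Prop := p.support.Nodup

/-- The shortest-path quasimetric, with value `⊤` if there is no path. -/
def dist (G : WDigraph) (a b : G.V) : EReal :=
  ⨅ p : {p : G.Trail a b // p.IsPath}, ((p.1.length : ℝ) : EReal)

/-- The digraph `G^t` of the shortest-path filtration. -/
def filtration (G : WDigraph) (t : ℝ) : Digraph G.V where
  Adj a b := a ≠ b ∧ G.dist a b ≤ (t : EReal)

theorem filtration_mono (G : WDigraph) {s t : ℝ} (h : s ≤ t) :
    G.filtration s ≤ G.filtration t :=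
  fun _ _ hab => ⟨hab.1, hab.2.trans (EReal.coe_le_coe_iff.2 h)⟩

/-! ### Medial subdivision -/

/-- The edges of the medial subdivision: each edge `e = (a, b)` of `G` is replaced by the two edges
`(a, v_e)` and `(v_e, b)`, where `v_e` is a new vertex. -/
def medialAdj (G : WDigraph) : G.V ⊕ G.Edge → G.V ⊕ G.Edge → Prop
  | .inl a, .inr e => e.1.1 = a
  | .inr e, .inl b => e.1.2 = b
  | .inl _, .inl _ => False
  | .inr _, .inr _ => False

/-- Both halves of an edge `e` have weight `w(e) / 2`. -/
def medialWeight (G : WDigraph) :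
    (x y : G.V ⊕ G.Edge) → G.medialAdj x y → ℝ
  | .inl _, .inr e, _ => G.weight e / 2
  | .inr e, .inl _, _ => G.weight e / 2
  | .inl _, .inl _, h => h.elim
  | .inr _, .inr _, h => h.elim

/-- The medial subdivision: every edge is halved. -/
def medial (G : WDigraph) : WDigraph where
  V := G.V ⊕ G.Edge
  finite := by
    have := G.finite
    infer_instance
  graph := ⟨G.medialAdj⟩
  loopless := by
    rintro (v | e) h
    · exact h
    · exact h
  weight e := G.medialWeight e.1.1 e.1.2 e.2
  weight_pos := by
    rintro ⟨⟨a | e, b | e'⟩, h⟩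
    · exact h.elim
    · exact half_pos (G.weight_pos e')
    · exact half_pos (G.weight_pos e)
    · exact h.elim

/-- The `n`-th iterated medial subdivision. -/
def iteratedMedial (G : WDigraph) : ℕ → WDigraph
  | 0 => G
  | n + 1 => (G.iteratedMedial n).medial

end WDigraph

/-! ## Regular path complex, with real coefficients -/

/-- The real vector space `Λ_p` freely generated by all elementary `p`-paths `v₀ … v_p`. -/
def Elem (V : Type) (p : ℕ) : Type := (Fin (p + 1) → V) →₀ ℝ

instance (V : Type) (p : ℕ) : AddCommGroup (Elem V p) :=
  inferInstanceAs (AddCommGroup ((Fin (p + 1) → V) →₀ ℝ))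

instance (V : Type) (p : ℕ) : Module ℝ (Elem V p) :=
  inferInstanceAs (Module ℝ ((Fin (p + 1) → V) →₀ ℝ))

/-- The basis of elementary paths. -/
def elemBasis (V : Type) (p : ℕ) : Module.Basis (Fin (p + 1) → V) ℝ (Elem V p) :=
  Module.Basis.ofRepr (LinearEquiv.refl ℝ ((Fin (p + 1) → V) →₀ ℝ))

/-- `v_i ≠ v_{i+1}` for all `i`. -/
def IsRegular {V : Type} {p : ℕ} (v : Fin (p + 1) → V) : Prop :=
  ∀ i : Fin p, v i.castSucc ≠ v i.succ

/-- `v_i → v_{i+1}` for all `i`. -/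
def IsAllowed {V : Type} (D : Digraph V) {p : ℕ} (v : Fin (p + 1) → V) : Prop :=
  ∀ i : Fin p, D.Adj (v i.castSucc) (v i.succ)

/-- The non-regular boundary map `v₀ … v_p ↦ ∑ (-1)^i v₀ … v̂_i … v_p`, from degree `p + 1` to
degree `p`. -/
def nonregularBoundary (V : Type) (p : ℕ) : Elem V (p + 1) →ₗ[ℝ] Elem V p :=
  (elemBasis V (p + 1)).constr ℝ fun v : Fin (p + 2) → V =>
    ∑ i : Fin (p + 2), (-1 : ℝ) ^ (i : ℕ) • elemBasis V p (v ∘ i.succAbove)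

open Classical in
/-- The projection onto the span of the regular paths, killing the non-regular paths. -/
def regularProj (V : Type) (p : ℕ) : Elem V p →ₗ[ℝ] Elem V p :=
  (elemBasis V p).constr ℝ fun v : Fin (p + 1) → V =>
    if IsRegular v then elemBasis V p v else 0

/-- The regular boundary map, from degree `p + 1` to degree `p`. It is used only on spans of
allowed paths of loopless digraphs, and these paths are regular. -/
def boundary (V : Type) (p : ℕ) : Elem V (p + 1) →ₗ[ℝ] Elem V p :=
  regularProj V p ∘ₗ nonregularBoundary V p

theorem boundary_boundary (V : Type) (x : Elem V 2) : boundary V 0 (boundary V 1 x) = 0 := by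
  suffices h : boundary V 0 ∘ₗ boundary V 1 = 0 from LinearMap.congr_fun h x
  have hreg : ∀ u : Fin 1 → V, IsRegular u := fun u i => i.elim0
  have h1 : boundary V 0 ∘ₗ regularProj V 1 = boundary V 0 := by
    refine (elemBasis V 1).ext fun v => ?_
    by_cases hv : IsRegular v
    · simp [regularProj, hv]
    · have h01 : v 0 = v 1 := by
        by_contra h
        exact hv fun i => by fin_cases i; exact h
      have e : v ∘ (1 : Fin 2).succAbove = v ∘ (0 : Fin 2).succAbove := by
        funext i
        fin_cases i
        exact h01
      simp [regularProj, hv, boundary, nonregularBoundary, hreg, Fin.sum_univ_two, e]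
  rw [show boundary V 1 = regularProj V 1 ∘ₗ nonregularBoundary V 1 from rfl,
    ← LinearMap.comp_assoc, h1]
  refine (elemBasis V 2).ext fun v => ?_
  have e1 : (v ∘ (0 : Fin 3).succAbove) ∘ (0 : Fin 2).succAbove =
      (v ∘ (1 : Fin 3).succAbove) ∘ (0 : Fin 2).succAbove := by
    funext i; fin_cases i; rfl
  have e2 : (v ∘ (0 : Fin 3).succAbove) ∘ (1 : Fin 2).succAbove =
      (v ∘ (2 : Fin 3).succAbove) ∘ (0 : Fin 2).succAbove := by
    funext i; fin_cases i; rfl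
  have e3 : (v ∘ (1 : Fin 3).succAbove) ∘ (1 : Fin 2).succAbove =
      (v ∘ (2 : Fin 3).succAbove) ∘ (1 : Fin 2).succAbove := by
    funext i; fin_cases i; rfl
  have b1 : ∀ u : Fin 2 → V, boundary V 0 (elemBasis V 1 u) =
      elemBasis V 0 (u ∘ (0 : Fin 2).succAbove) - elemBasis V 0 (u ∘ (1 : Fin 2).succAbove) := by
    intro u
    simp [boundary, regularProj, nonregularBoundary, hreg, Fin.sum_univ_two, sub_eq_add_neg]
  have b2 : nonregularBoundary V 1 (elemBasis V 2 v) =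
      elemBasis V 1 (v ∘ (0 : Fin 3).succAbove) - elemBasis V 1 (v ∘ (1 : Fin 3).succAbove) +
        elemBasis V 1 (v ∘ (2 : Fin 3).succAbove) := by
    rw [nonregularBoundary, Module.Basis.constr_basis, Fin.sum_univ_three]
    simp [sub_eq_add_neg]
  rw [LinearMap.comp_apply]
  erw [b2]
  rw [map_add, map_sub, b1, b1, b1, e1, e2, e3, LinearMap.zero_apply]
  abel

/-- The span of the allowed `p`-paths. -/
def allowed {V : Type} (D : Digraph V) (p : ℕ) : Submodule ℝ (Elem V p) :=
  Submodule.span ℝ (elemBasis V p '' {v | IsAllowed D v})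

/-- The space `Ω_p` of boundary-invariant `p`-paths: allowed chains with allowed boundary. -/
def Omega {V : Type} (D : Digraph V) : (p : ℕ) → Submodule ℝ (Elem V p)
  | 0 => allowed D 0
  | p + 1 => allowed D (p + 1) ⊓ (allowed D p).comap (boundary V p)

theorem allowed_mono {V : Type} {D D' : Digraph V} (h : D ≤ D') (p : ℕ) :
    allowed D p ≤ allowed D' p :=
  Submodule.span_mono (Set.image_mono fun _ hv i => h (hv i))

theorem Omega_mono {V : Type} {D D' : Digraph V} (h : D ≤ D') : ∀ p, Omega D p ≤ Omega D' p
  | 0 => allowed_mono h 0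
  | p + 1 => inf_le_inf (allowed_mono h _) (Submodule.comap_mono (allowed_mono h p))

/-! ## Grounded persistent path homology -/

/-- The quotient `Z / B` of two subspaces `B ≤ Z` of a vector space. -/
abbrev Subquotient {M : Type} [AddCommGroup M] [Module ℝ M] (Z B : Submodule ℝ M) : Type :=
  Z ⧸ B.submoduleOf Z

/-- The map `Z / B → Z' / B'` induced by inclusions `Z ≤ Z'` and `B ≤ B'`. -/
def subquotientMap {M : Type} [AddCommGroup M] [Module ℝ M] {Z B Z' B' : Submodule ℝ M}
    (hZ : Z ≤ Z') (hB : B ≤ B') : Subquotient Z B →ₗ[ℝ] Subquotient Z' B' :=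
  Submodule.mapQ _ _ (Submodule.inclusion hZ) fun _ hx => hB hx

theorem subquotientMap_id {M : Type} [AddCommGroup M] [Module ℝ M] {Z B : Submodule ℝ M}
    (hZ : Z ≤ Z) (hB : B ≤ B) : subquotientMap hZ hB = LinearMap.id :=
  Submodule.linearMap_qext _ rfl

theorem subquotientMap_comp {M : Type} [AddCommGroup M] [Module ℝ M]
    {Z B Z' B' Z'' B'' : Submodule ℝ M} (hZ : Z ≤ Z') (hB : B ≤ B') (hZ' : Z' ≤ Z'')
    (hB' : B' ≤ B'') : subquotientMap (hZ.trans hZ') (hB.trans hB') =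
      subquotientMap hZ' hB' ∘ₗ subquotientMap hZ hB :=
  Submodule.linearMap_qext _ rfl

namespace WDigraph

open Classical in
/-- The grounded chain groups: `Ω_k(G ∪ G^t)` in degrees `k ≤ 1` and `Ω_k(G^t)` in degrees `k ≥ 2`.
The filtration starts at `t = 0`, i.e. everything vanishes for `t < 0`. -/
def groundedChains (G : WDigraph) (t : ℝ) (k : ℕ) : Submodule ℝ (Elem G.V k) :=
  if t < 0 then ⊥
  else if k ≤ 1 then Omega (G.graph ⊔ G.filtration t) k
  else Omega (G.filtration t) k

/-- Grounded `1`-cycles. -/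
def groundedCycles (G : WDigraph) (t : ℝ) : Submodule ℝ (Elem G.V 1) :=
  G.groundedChains t 1 ⊓ LinearMap.ker (boundary G.V 0)

/-- Grounded `1`-boundaries. -/
def groundedBoundaries (G : WDigraph) (t : ℝ) : Submodule ℝ (Elem G.V 1) :=
  (G.groundedChains t 2).map (boundary G.V 1)

theorem groundedChains_mono (G : WDigraph) {s t : ℝ} (h : s ≤ t) (k : ℕ) :
    G.groundedChains s k ≤ G.groundedChains t k := by
  unfold groundedChains
  by_cases hs : s < 0
  · simp [hs]
  · have ht : ¬ t < 0 := fun h' => hs (h.trans_lt h')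
    simp only [hs, ht, if_false]
    split_ifs
    · exact Omega_mono (sup_le_sup_left (G.filtration_mono h) _) k
    · exact Omega_mono (G.filtration_mono h) k

theorem groundedCycles_mono (G : WDigraph) {s t : ℝ} (h : s ≤ t) :
    G.groundedCycles s ≤ G.groundedCycles t :=
  inf_le_inf_right _ (G.groundedChains_mono h 1)

theorem groundedBoundaries_mono (G : WDigraph) {s t : ℝ} (h : s ≤ t) :
    G.groundedBoundaries s ≤ G.groundedBoundaries t :=
  Submodule.map_mono (G.groundedChains_mono h 2)

/-- Boundaries are cycles. -/
theorem groundedBoundaries_le (G : WDigraph) (t : ℝ) :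
    G.groundedBoundaries t ≤ G.groundedCycles t := by
  rintro _ ⟨x, hx, rfl⟩
  refine ⟨?_, boundary_boundary G.V x⟩
  by_cases ht : t < 0
  · have h0 : x = 0 := by simpa [groundedChains, ht] using hx
    simp [h0]
  · have hx' : x ∈ Omega (G.filtration t) 2 := by simpa [groundedChains, ht] using hx
    have h1 : boundary G.V 1 x ∈ allowed (G.filtration t) 1 := hx'.2
    have h2 : boundary G.V 1 x ∈ Omega (G.graph ⊔ G.filtration t) 1 :=
      ⟨allowed_mono le_sup_right 1 h1, by
        rw [SetLike.mem_coe, Submodule.mem_comap, boundary_boundary]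
        exact Submodule.zero_mem _⟩
    simpa [groundedChains, ht] using h2

/-- The grounded homology `H₁(G, t)`: cycles modulo boundaries. -/
abbrev groundedHomology (G : WDigraph) (t : ℝ) : Type :=
  Subquotient (G.groundedCycles t) (G.groundedBoundaries t)

/-- The map `H₁(G, s) → H₁(G, t)` induced by the inclusion of chains, for `s ≤ t`. -/
def groundedHomologyMap (G : WDigraph) {s t : ℝ} (h : s ≤ t) :
    G.groundedHomology s →ₗ[ℝ] G.groundedHomology t :=
  subquotientMap (G.groundedCycles_mono h) (G.groundedBoundaries_mono h)

end WDigraph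

/-! ## Persistent vector spaces and barcodes -/

/-- Persistent vector spaces. -/
abbrev PersVec : Type 1 := ℝ ⥤ ModuleCat.{0} ℝ

/-- Grounded persistent path homology of a weighted digraph. -/
def WDigraph.grpph (G : WDigraph) : PersVec where
  obj t := ModuleCat.of ℝ (G.groundedHomology t)
  map f := ModuleCat.ofHom (G.groundedHomologyMap (leOfHom f))
  map_id t := by
    exact congrArg ModuleCat.ofHom (subquotientMap_id _ _)
  map_comp f g := by
    exact congrArg ModuleCat.ofHom (subquotientMap_comp
      (G.groundedCycles_mono (leOfHom f)) (G.groundedBoundaries_mono (leOfHom f))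
      (G.groundedCycles_mono (leOfHom g)) (G.groundedBoundaries_mono (leOfHom g)))

/-- A nonempty interval of `ℝ`, of any kind (open, closed, half-open, bounded or not). -/
structure RealInterval where
  carrier : Set ℝ
  nonempty : carrier.Nonempty
  ordConnected : carrier.OrdConnected

open Classical in
/-- The values of the interval module `P(I)`: the line `ℝ` on `I`, and `0` elsewhere. -/
def RealInterval.fiber (I : RealInterval) (t : ℝ) : Submodule ℝ ℝ :=
  if t ∈ I.carrier then ⊤ else ⊥

open Classical in
/-- The structure maps of `P(I)`: the identity of `ℝ` if both ends are in `I`, and `0` otherwise. -/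
def RealInterval.fiberMap (I : RealInterval) (s t : ℝ) : I.fiber s →ₗ[ℝ] I.fiber t :=
  if h : s ∈ I.carrier ∧ t ∈ I.carrier then
    Submodule.inclusion (by simp [fiber, h.1, h.2])
  else 0

theorem RealInterval.coe_fiberMap (I : RealInterval) {s t : ℝ} (h : t ∈ I.carrier)
    (x : I.fiber s) : ((I.fiberMap s t x : I.fiber t) : ℝ) = x := by
  by_cases hs : s ∈ I.carrier
  · simp [fiberMap, hs, h]
  · have hx : (x : ℝ) = 0 := by simpa [fiber, hs] using x.2
    simp [fiberMap, hs, hx]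

theorem RealInterval.fiber_eq_zero (I : RealInterval) {t : ℝ} (h : t ∉ I.carrier)
    (x : I.fiber t) : (x : ℝ) = 0 := by
  simpa [fiber, h] using x.2

/-- The interval module `P(I)`. -/
def RealInterval.module (I : RealInterval) : PersVec where
  obj t := ModuleCat.of ℝ (I.fiber t)
  map {s t} _ := ModuleCat.ofHom (I.fiberMap s t)
  map_id t := by
    refine ModuleCat.hom_ext (LinearMap.ext fun x : I.fiber t => Subtype.ext ?_)
    by_cases h : t ∈ I.carrier
    · exact I.coe_fiberMap h x
    · exact (I.fiber_eq_zero h _).trans (I.fiber_eq_zero h x).symm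
  map_comp {r s t} f g := by
    refine ModuleCat.hom_ext (LinearMap.ext fun x : I.fiber r => Subtype.ext ?_)
    change ((I.fiberMap r t x : I.fiber t) : ℝ) = (I.fiberMap s t (I.fiberMap r s x) : I.fiber t)
    by_cases ht : t ∈ I.carrier
    · rw [I.coe_fiberMap ht, I.coe_fiberMap ht]
      by_cases hs : s ∈ I.carrier
      · rw [I.coe_fiberMap hs]
      · have hr : r ∉ I.carrier := fun hr =>
          hs (I.ordConnected.out hr ht ⟨leOfHom f, leOfHom g⟩)
        rw [I.fiber_eq_zero hs, I.fiber_eq_zero hr]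
    · rw [I.fiber_eq_zero ht, I.fiber_eq_zero ht]

/-- The pointwise direct sum of a family of persistent vector spaces. -/
def directSum {ι : Type} (M : ι → PersVec) : PersVec where
  obj t := ModuleCat.of ℝ (⨁ i, (M i).obj t)
  map f := ModuleCat.ofHom (DirectSum.lmap fun i => ((M i).map f).hom)
  map_id t := by
    ext x
    simp
  map_comp f g := by
    ext x
    simp

/-- A barcode: a multiset of nonempty intervals, given as a family. -/
structure Barcode where
  ι : Type
  bar : ι → RealInterval

/-- `B` is a barcode of `M`: there is an isomorphism `M ≅ ⨁_{I ∈ B} P(I)`. -/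
def IsBarcodeOf (B : Barcode) (M : PersVec) : Prop :=
  Nonempty (M ≅ directSum fun i => (B.bar i).module)

/-! ## Bottleneck distance -/

/-- The pair of endpoints `(inf I, sup I)` of an interval, in the extended plane. -/
def RealInterval.endpoints (I : RealInterval) : EReal × EReal :=
  (sInf ((fun x : ℝ => (x : EReal)) '' I.carrier), sSup ((fun x : ℝ => (x : EReal)) '' I.carrier))

/-- The multiset `Dgm(B) ∪ Δ`, as a family: the endpoints of the bars, and each point `(x, x)` of the
diagonal once. -/
def Barcode.diagram (B : Barcode) : B.ι ⊕ ℝ → EReal × EReal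
  | .inl i => (B.bar i).endpoints
  | .inr x => ((x : EReal), (x : EReal))

open Classical in
/-- `|x - y|` for extended reals; an infinite value is at distance `0` from itself and at distance
`∞` from every other value. -/
def coordDist (x y : EReal) : ℝ≥0∞ := if x = y then 0 else (x - y).abs

/-- The sup-distance of two points of the extended plane. -/
def planeDist (p q : EReal × EReal) : ℝ≥0∞ := max (coordDist p.1 q.1) (coordDist p.2 q.2)

/-- The bottleneck distance: the infimum over all multi-bijections `γ : Dgm(B) ∪ Δ → Dgm(B') ∪ Δ` of
`sup_x ‖x - γ(x)‖_∞`. -/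
def bottleneckDist (B B' : Barcode) : ℝ≥0∞ :=
  ⨅ γ : (B.ι ⊕ ℝ) ≃ (B'.ι ⊕ ℝ), ⨆ x, planeDist (B.diagram x) (B'.diagram (γ x))

end GrPPH

end

noncomputable section

namespace GrPPH

/-!
For `t ≥ 0` the group `H₁(G, t)` is a quotient of the cycle space of `G`: an edge of `G^t` is
homologous to a shortest path of `G` that realizes it. Hence every bar starts at `0`, and the
endpoints of the bars are determined by `t ↦ dim H₁(G, t)`, which is nonincreasing on `[0, ∞)`.

A medial subdivision identifies the cycle spaces, with inverse induced by collapsing the second half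
of every edge. If the weights are at most `c`, then subdividing and collapsing take boundaries at
`t` to boundaries at `t + c`, so the sorted death times move by at most `c`. The `n`-th iterated
subdivision has weights at most `c / 2 ^ n`, so the finite death times form Cauchy sequences.
-/

/-! ## Linear algebra -/

section LinearAlgebra

open Module Submodule

variable {K E : Type*} [DivisionRing K] [AddCommGroup E] [Module K E]

theorem finrank_le_finrank_of_ker_le_ker {F F' : Type*} [AddCommGroup F] [Module K F]
    [AddCommGroup F'] [Module K F'] [Module.Finite K F] {p : E →ₗ[K] F} {q : E →ₗ[K] F'}
    (hq : Function.Surjective q) (hker : LinearMap.ker p ≤ LinearMap.ker q) :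
    finrank K F' ≤ finrank K F := by
  have : Module.Finite K (E ⧸ LinearMap.ker p) := .equiv p.quotKerEquivRange.symm
  have hlift : Function.Surjective ((LinearMap.ker p).liftQ q hker) :=
    LinearMap.range_eq_top.1 (by rw [range_liftQ, LinearMap.range_eq_top.2 hq])
  calc finrank K F' ≤ finrank K (E ⧸ LinearMap.ker p) :=
        LinearMap.finrank_le_finrank_of_surjective hlift
    _ = finrank K (LinearMap.range p) := p.quotKerEquivRange.finrank_eq
    _ ≤ finrank K F := finrank_le _

theorem exists_linearIndepOn_span_inter_eq_of_finrank_le [Module.Finite K E]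
    {C : Set (Submodule K E)} (hC : IsChain (· ≤ ·) C) (n : ℕ) :
    ∃ S : Set E, LinearIndepOn K id S ∧ ∀ U ∈ C, finrank K U ≤ n → span K (S ∩ U) = U := by
  induction n with
  | zero =>
    refine ⟨∅, linearIndepOn_empty K id, fun U _ hU => ?_⟩
    rw [Set.empty_inter, span_empty, finrank_eq_zero.1 (Nat.le_zero.1 hU)]
  | succ n ih =>
    obtain ⟨S, hS, hspan⟩ := ih
    by_cases hW : ∃ W ∈ C, finrank K W = n + 1
    · obtain ⟨W, hWC, hWrank⟩ := hW
      obtain ⟨T, hTW, hST, hWT, hT⟩ := exists_linearIndepOn_id_extension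
        (hS.mono (Set.inter_subset_left (t := (W : Set E)))) Set.inter_subset_right
      refine ⟨T, hT, fun U hU hrank => le_antisymm (span_le.2 Set.inter_subset_right) ?_⟩
      have hUW : U ≤ W := (hC.total hU hWC).elim id fun hWU =>
        (eq_of_le_of_finrank_le hWU (hrank.trans hWrank.ge)).ge
      rcases hrank.lt_or_eq with hlt | heq
      · calc U = span K (S ∩ U) := (hspan U hU (Nat.le_of_lt_succ hlt)).symm
          _ ≤ span K (T ∩ U) := span_mono fun x hx => ⟨hST ⟨hx.1, hUW hx.2⟩, hx.2⟩
      · obtain rfl : U = W := eq_of_le_of_finrank_eq hUW (heq.trans hWrank.symm)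
        rwa [Set.inter_eq_left.2 hTW]
    · push Not at hW
      exact ⟨S, hS, fun U hU hrank =>
        hspan U hU (Nat.le_of_lt_succ (hrank.lt_of_ne (hW U hU)))⟩

theorem exists_linearIndepOn_span_inter_eq [Module.Finite K E] {C : Set (Submodule K E)}
    (hC : IsChain (· ≤ ·) C) :
    ∃ S : Set E, LinearIndepOn K id S ∧ ∀ U ∈ C, span K (S ∩ U) = U := by
  obtain ⟨S, hS, hspan⟩ :=
    exists_linearIndepOn_span_inter_eq_of_finrank_le hC (finrank K E)
  exact ⟨S, hS, fun U hU => hspan U hU (finrank_le U)⟩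

section SDiffKer

variable {F : Type*} [AddCommGroup F] [Module K F] {f : E →ₗ[K] F} {S : Set E}

theorem linearIndepOn_sdiff_ker (hS : LinearIndepOn K id S)
    (hker : span K (S ∩ LinearMap.ker f) = LinearMap.ker f) :
    LinearIndepOn K f (S \ LinearMap.ker f) := by
  have hdisj := hS.linearIndependent.disjoint_span_image
    (disjoint_compl_left.preimage (Subtype.val : S → E) (s := (LinearMap.ker f : Set E)ᶜ))
  change Disjoint (span K (Subtype.val '' _)) (span K (Subtype.val '' _)) at hdisj
  rw [Subtype.image_preimage_coe, Subtype.image_preimage_coe, hker, ← Set.sdiff_eq] at hdisj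
  exact (hS.mono Set.sdiff_subset).map (by simpa only [id, Subtype.range_coe] using hdisj)

theorem span_image_sdiff_ker (hS : span K S = ⊤) (hf : Function.Surjective f) :
    span K (f '' (S \ LinearMap.ker f)) = ⊤ := by
  rw [eq_top_iff, ← LinearMap.range_eq_top.2 hf, LinearMap.range_eq_map, ← hS, map_span_le]
  intro x hx
  by_cases hker : x ∈ LinearMap.ker f
  · exact LinearMap.mem_ker.1 hker ▸ zero_mem _
  · exact subset_span ⟨x, ⟨hx, hker⟩, rfl⟩

end SDiffKer

end LinearAlgebra

/-! ## Barcodes and bases -/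

section BarcodeBasis

open Module

/-- The indices of the bars that contain `t`. -/
def Barcode.alive (B : Barcode) (t : ℝ) : Set B.ι :=
  {i | t ∈ (B.bar i).carrier}

open Classical in
/-- A system of bases of the values of `M`, indexed by the bars of `B`, such that each structure map
sends a basis vector to the basis vector of the same bar, or to `0` once the bar has ended. -/
structure BarcodeBasis (B : Barcode) (M : PersVec) where
  basis (t : ℝ) : Basis (B.alive t) ℝ (M.obj t)
  map_basis {s t : ℝ} (f : s ⟶ t) (i : B.alive s) :
    (M.map f).hom (basis s i) = if h : i.1 ∈ B.alive t then basis t ⟨i, h⟩ else 0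

namespace BarcodeBasis

variable {B : Barcode} {M N : PersVec}

/-- The isomorphism that identifies the basis vectors of each bar. -/
def iso (b : BarcodeBasis B M) (c : BarcodeBasis B N) : M ≅ N :=
  NatIso.ofComponents (fun t => ((b.basis t).equiv (c.basis t) (Equiv.refl _)).toModuleIso)
    fun {s t} f => by
      refine ModuleCat.hom_ext ((b.basis s).ext fun i => ?_)
      change (b.basis t).equiv (c.basis t) (Equiv.refl _) ((M.map f).hom (b.basis s i)) =
        (N.map f).hom ((b.basis s).equiv (c.basis s) (Equiv.refl _) (b.basis s i))
      rw [Basis.equiv_apply, Equiv.refl_apply, b.map_basis, c.map_basis]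
      split_ifs
      · exact Basis.equiv_apply ..
      · exact map_zero _

/-- Transport of a barcode basis along an isomorphism. -/
def ofIso (b : BarcodeBasis B M) (e : M ≅ N) : BarcodeBasis B N where
  basis t := (b.basis t).map (e.app t).toLinearEquiv
  map_basis {s t} f i := by
    have hnat := congrArg (fun φ => φ.hom (b.basis s i)) (e.hom.naturality f)
    refine hnat.symm.trans ?_
    change (e.app t).toLinearEquiv ((M.map f).hom (b.basis s i)) = _
    rw [b.map_basis]
    split_ifs
    · rfl
    · exact map_zero _

end BarcodeBasis

section DirectSum

open Classical in
/-- The generator of the summand of a bar that contains `t`. -/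
def Barcode.generator (B : Barcode) (t : ℝ) (i : B.alive t) : ⨁ j, (B.bar j).fiber t :=
  DirectSum.lof ℝ B.ι (fun j => (B.bar j).fiber t) i
    ⟨1, by simp [RealInterval.fiber, show t ∈ (B.bar i).carrier from i.2]⟩

variable (B : Barcode) {t : ℝ}

open Classical in
theorem Barcode.coe_generator_apply (i : B.alive t) (j : B.ι) :
    (B.generator t i j : ℝ) = if j = i then 1 else 0 := by
  rw [Barcode.generator, DirectSum.lof_eq_of]
  split_ifs with h
  · rw [h, DirectSum.of_eq_same]
  · rw [DirectSum.of_eq_of_ne _ _ _ h, ZeroMemClass.coe_zero]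

open Classical in
theorem Barcode.lmap_generator (s t : ℝ) (i : B.alive s) :
    DirectSum.lmap (fun j => (B.bar j).fiberMap s t) (B.generator s i) =
      if h : i.1 ∈ B.alive t then B.generator t ⟨i, h⟩ else 0 := by
  rw [Barcode.generator, DirectSum.lmap_lof]
  split_ifs with h
  · exact congrArg _ (Subtype.ext (RealInterval.coe_fiberMap _ h _))
  · rw [← map_zero (DirectSum.lof ℝ B.ι (fun j => (B.bar j).fiber t) i)]
    exact congrArg _ (Subtype.ext (RealInterval.fiber_eq_zero _ h _))

theorem Barcode.linearIndependent_generator : LinearIndependent ℝ (B.generator t) := by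
  classical
  refine linearIndependent_iff'.2 fun T g hg i hi => ?_
  let coord := ((B.bar i).fiber t).subtype ∘ₗ
    DirectSum.component ℝ B.ι (fun j => (B.bar j).fiber t) i
  have hcoord (j : B.alive t) : coord (B.generator t j) = if i.1 = j then 1 else 0 :=
    B.coe_generator_apply j i
  simpa only [map_sum, map_smul, hcoord, Subtype.coe_inj, smul_eq_mul, mul_ite, mul_one, mul_zero,
    Finset.sum_ite_eq, hi, if_true, map_zero] using congrArg coord hg

theorem Barcode.span_generator : Submodule.span ℝ (Set.range (B.generator t)) = ⊤ := by
  classical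
  refine eq_top_iff.2 fun x _ => ?_
  induction x using DirectSum.induction_on with
  | zero => exact zero_mem _
  | add x y hx hy => exact add_mem (hx trivial) (hy trivial)
  | of i x =>
    by_cases hi : t ∈ (B.bar i).carrier
    · have hx : DirectSum.lof ℝ B.ι (fun j => (B.bar j).fiber t) i x =
          (x : ℝ) • B.generator t ⟨i, hi⟩ := by
        rw [Barcode.generator, ← map_smul]
        exact congrArg _ (Subtype.ext (mul_one (x : ℝ)).symm)
      exact hx ▸ Submodule.smul_mem _ _ (Submodule.subset_span ⟨_, rfl⟩)
    · have hx : x = 0 := Subtype.ext ((B.bar i).fiber_eq_zero hi x)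
      rw [hx, map_zero]
      exact zero_mem _

/-- The basis of the value at `t` of the sum of the interval modules given by the generators. -/
def Barcode.generatorBasis (t : ℝ) : Basis (B.alive t) ℝ (⨁ i, (B.bar i).fiber t) :=
  .mk B.linearIndependent_generator B.span_generator.ge

/-- The generators of the interval modules of a barcode form a barcode basis of their sum. -/
def Barcode.directSumBasis : BarcodeBasis B (directSum fun i => (B.bar i).module) where
  basis := B.generatorBasis
  map_basis {s t} _ i := by
    classical
    change DirectSum.lmap (fun j => (B.bar j).fiberMap s t) (B.generatorBasis s i) =
      if h : i.1 ∈ B.alive t then B.generatorBasis t ⟨i, h⟩ else 0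
    simp only [Barcode.generatorBasis, Basis.mk_apply, B.lmap_generator]

end DirectSum

theorem isBarcodeOf_iff_nonempty_barcodeBasis {B : Barcode} {M : PersVec} :
    IsBarcodeOf B M ↔ Nonempty (BarcodeBasis B M) :=
  ⟨fun ⟨e⟩ => ⟨B.directSumBasis.ofIso e.symm⟩, fun ⟨b⟩ => ⟨b.iso B.directSumBasis⟩⟩

end BarcodeBasis

/-! ## Grounded persistent vector spaces -/

section Grounded

open Module

theorem map_map_apply (M : PersVec) {r s t : ℝ} (f : r ⟶ s) (g : s ⟶ t) (h : r ⟶ t)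
    (x : M.obj r) : (M.map g).hom ((M.map f).hom x) = (M.map h).hom x := by
  rw [Subsingleton.elim h (f ≫ g), M.map_comp]
  rfl

/-- A persistent vector space is grounded if it vanishes at negative parameters and each of its
values at `t ≥ 0` is a quotient of its finite-dimensional value at `0`. -/
structure IsGrounded (M : PersVec) : Prop where
  subsingleton : ∀ t < 0, Subsingleton (M.obj t)
  finite : Module.Finite ℝ (M.obj 0)
  surjective : ∀ t (h : 0 ≤ t), Function.Surjective (M.map (homOfLE h)).hom

namespace IsBarcodeOf

variable {B : Barcode} {M : PersVec}

theorem card_alive (hB : IsBarcodeOf B M) (t : ℝ) :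
    Nat.card (B.alive t) = finrank ℝ (M.obj t) := by
  obtain ⟨b⟩ := isBarcodeOf_iff_nonempty_barcodeBasis.1 hB
  exact (finrank_eq_nat_card_basis (b.basis t)).symm

theorem nonneg (hM : IsGrounded M) (hB : IsBarcodeOf B M) {i : B.ι} {t : ℝ} (hi : i ∈ B.alive t) :
    0 ≤ t := by
  obtain ⟨b⟩ := isBarcodeOf_iff_nonempty_barcodeBasis.1 hB
  by_contra! ht
  exact (b.basis t).ne_zero ⟨i, hi⟩ ((hM.subsingleton t ht).elim _ _)

theorem alive_zero (hM : IsGrounded M) (hB : IsBarcodeOf B M) : B.alive 0 = Set.univ := by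
  refine Set.eq_univ_of_forall fun i => ?_
  obtain ⟨t, hi : i ∈ B.alive t⟩ := (B.bar i).nonempty
  have ht := hB.nonneg hM hi
  obtain ⟨b⟩ := isBarcodeOf_iff_nonempty_barcodeBasis.1 hB
  by_contra hi₀
  have hcoord : (b.basis t).coord ⟨i, hi⟩ ∘ₗ (M.map (homOfLE ht)).hom = 0 := by
    refine (b.basis 0).ext fun j => ?_
    have hji : j.1 ≠ i := fun h => hi₀ (h ▸ j.2)
    rw [LinearMap.comp_apply, b.map_basis]
    split_ifs
    · rw [Basis.coord_apply, Basis.repr_self, Finsupp.single_eq_of_ne, LinearMap.zero_apply]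
      exact fun h => hji (congrArg Subtype.val h).symm
    · simp only [map_zero, LinearMap.zero_apply]
  obtain ⟨x, hx⟩ := hM.surjective t ht (b.basis t ⟨i, hi⟩)
  have := LinearMap.congr_fun hcoord x
  rw [LinearMap.comp_apply, hx, Basis.coord_apply, Basis.repr_self, Finsupp.single_eq_same] at this
  exact one_ne_zero this

theorem finite (hM : IsGrounded M) (hB : IsBarcodeOf B M) : Finite B.ι := by
  have hzero := hB.alive_zero hM
  obtain ⟨b⟩ := isBarcodeOf_iff_nonempty_barcodeBasis.1 hB
  have := hM.finite
  exact Set.finite_univ_iff.1 (hzero ▸ Module.Finite.finite_basis (b.basis 0))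

end IsBarcodeOf

section Lifespan

variable {M : PersVec}

/-- The interval of the parameters `t ≥ 0` at which the image of `x` does not vanish. -/
def lifespan (M : PersVec) (x : M.obj 0) (hx : x ≠ 0) : RealInterval where
  carrier := {t | ∃ h : 0 ≤ t, (M.map (homOfLE h)).hom x ≠ 0}
  nonempty := ⟨0, le_rfl, by
    rwa [Subsingleton.elim (homOfLE (le_refl (0 : ℝ))) (𝟙 0), M.map_id]⟩
  ordConnected := by
    refine ⟨fun s ⟨hs, _⟩ t ⟨ht, hxt⟩ u hu => ⟨hs.trans hu.1, fun h => hxt ?_⟩⟩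
    rw [← map_map_apply M (homOfLE (hs.trans hu.1)) (homOfLE hu.2), h, map_zero]

/-- The barcode of the lifespans of the elements of a linearly independent set. -/
abbrev lifespans {S : Set (M.obj 0)} (hS : LinearIndepOn ℝ id S) : Barcode where
  ι := S
  bar x := lifespan M x (hS.ne_zero x.2)

variable {S : Set (M.obj 0)} (hS : LinearIndepOn ℝ id S) {t : ℝ}

theorem isEmpty_alive_lifespans (ht : t < 0) : IsEmpty ((lifespans hS).alive t) :=
  ⟨fun ⟨_, h, _⟩ => ht.not_ge h⟩

/-- The image at `t` of the element to which a bar of `lifespans hS` belongs. -/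
def survivor (t : ℝ) (x : (lifespans hS).alive t) : M.obj t :=
  (M.map (homOfLE x.2.1)).hom x.1.1

variable {hS}

theorem linearIndependent_survivor
    (hker : ∀ s (h : 0 ≤ s), Submodule.span ℝ (S ∩ LinearMap.ker (M.map (homOfLE h)).hom) =
      LinearMap.ker (M.map (homOfLE h)).hom) :
    LinearIndependent ℝ (survivor hS t) := by
  rcases lt_or_ge t 0 with ht | ht
  · have := isEmpty_alive_lifespans hS ht
    exact linearIndependent_empty_type
  · exact (linearIndepOn_sdiff_ker hS (hker t ht)).comp
      (fun x : (lifespans hS).alive t => ⟨x.1.1, x.1.2, x.2.2⟩)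
      fun _ _ h => Subtype.ext (Subtype.ext (Subtype.mk.inj h))

theorem span_range_survivor (hM : IsGrounded M) (htop : Submodule.span ℝ S = ⊤) :
    Submodule.span ℝ (Set.range (survivor hS t)) = ⊤ := by
  rcases lt_or_ge t 0 with ht | ht
  · have := hM.subsingleton t ht
    exact Subsingleton.elim _ _
  · rw [← span_image_sdiff_ker htop (hM.surjective t ht)]
    congr 1
    ext y
    constructor
    · rintro ⟨x, rfl⟩
      exact ⟨x.1, ⟨x.1.2, x.2.2⟩, rfl⟩
    · rintro ⟨x, hx, rfl⟩
      exact ⟨⟨⟨x, hx.1⟩, ht, hx.2⟩, rfl⟩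

/-- The surviving elements of `S` form a barcode basis if `S` is a basis adapted to the kernels. -/
def survivorBasis (hM : IsGrounded M) (htop : Submodule.span ℝ S = ⊤)
    (hker : ∀ s (h : 0 ≤ s), Submodule.span ℝ (S ∩ LinearMap.ker (M.map (homOfLE h)).hom) =
      LinearMap.ker (M.map (homOfLE h)).hom) :
    BarcodeBasis (lifespans hS) M where
  basis _ := .mk (linearIndependent_survivor hker) (span_range_survivor hM htop).ge
  map_basis {s t} f x := by
    have hmap : (M.map f).hom (survivor hS s x) =
        (M.map (homOfLE (x.2.1.trans (leOfHom f)))).hom x.1.1 := map_map_apply ..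
    simp only [Basis.mk_apply, hmap]
    split_ifs with hx
    · rfl
    · exact not_not.1 fun h => hx ⟨_, h⟩

end Lifespan

theorem isChain_range_ker (M : PersVec) :
    IsChain (· ≤ ·) (Set.range fun t : {t : ℝ // 0 ≤ t} =>
      LinearMap.ker (M.map (homOfLE t.2)).hom) := by
  refine Monotone.isChain_range fun s t hst x hx => ?_
  rw [LinearMap.mem_ker] at hx ⊢
  rw [← map_map_apply M (homOfLE s.2) (homOfLE (show s.1 ≤ t.1 from hst)), hx, map_zero]

theorem IsGrounded.exists_isBarcodeOf {M : PersVec} (hM : IsGrounded M) :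
    ∃ B : Barcode, IsBarcodeOf B M := by
  have := hM.finite
  obtain ⟨S, hS, hspan⟩ := exists_linearIndepOn_span_inter_eq
    ((isChain_range_ker M).insert fun _ _ _ => Or.inr le_top)
  have htop := hspan ⊤ (Set.mem_insert ..)
  rw [Submodule.top_coe, Set.inter_univ] at htop
  exact ⟨lifespans hS, isBarcodeOf_iff_nonempty_barcodeBasis.2
    ⟨survivorBasis hM htop fun t ht => hspan _ (Set.mem_insert_of_mem _ ⟨⟨t, ht⟩, rfl⟩)⟩⟩

end Grounded

/-! ## Death times -/

section DeathTime

open Module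

theorem RealInterval.coe_le_snd_endpoints {I : RealInterval} {t : ℝ} (ht : t ∈ I.carrier) :
    (t : EReal) ≤ I.endpoints.2 :=
  le_sSup ⟨t, ht, rfl⟩

theorem RealInterval.mem_of_lt_snd_endpoints {I : RealInterval} {s t : ℝ} (hs : s ∈ I.carrier)
    (hst : s ≤ t) (ht : (t : EReal) < I.endpoints.2) : t ∈ I.carrier := by
  obtain ⟨_, ⟨u, hu, rfl⟩, htu⟩ := lt_sSup_iff.1 ht
  exact I.ordConnected.out hs hu ⟨hst, (EReal.coe_lt_coe_iff.1 htu).le⟩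

theorem RealInterval.fst_endpoints_of_isLeast {I : RealInterval} {t : ℝ}
    (ht : IsLeast I.carrier t) : I.endpoints.1 = t :=
  ((EReal.coe_strictMono.monotone.map_isLeast ht).isGLB).sInf_eq

/-- The supremum of the parameters at which the dimension of `M` exceeds `k`: the right endpoint of
the bar of index `k` when the bars of a grounded `M` are listed from the longest to the shortest. -/
def deathTime (M : PersVec) (k : ℕ) : EReal :=
  ⨆ (t : ℝ) (_ : k < finrank ℝ (M.obj t)), (t : EReal)

variable {M N : PersVec}

theorem coe_le_deathTime {k : ℕ} {t : ℝ} (h : k < finrank ℝ (M.obj t)) :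
    (t : EReal) ≤ deathTime M k :=
  le_iSup₂_of_le t h le_rfl

theorem deathTime_nonneg {k : ℕ} (h : k < finrank ℝ (M.obj 0)) : 0 ≤ deathTime M k :=
  coe_le_deathTime h

theorem deathTime_le_add {k : ℕ} {ε : ℝ} (hk : k < finrank ℝ (M.obj 0))
    (hrank : ∀ t, 0 ≤ t → finrank ℝ (N.obj (t + ε)) ≤ finrank ℝ (M.obj t)) :
    deathTime N k ≤ deathTime M k + ε := by
  refine iSup₂_le fun t ht => ?_
  obtain ⟨s, rfl⟩ : ∃ s, s + ε = t := ⟨t - ε, sub_add_cancel t ε⟩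
  have hs : (s : EReal) ≤ deathTime M k := by
    rcases le_total 0 s with hs | hs
    · exact coe_le_deathTime (ht.trans_le (hrank s hs))
    · exact (EReal.coe_nonpos.2 hs).trans (deathTime_nonneg hk)
  exact EReal.coe_add s ε ▸ add_le_add_left hs ε

/-- The dimensions of `M` and `N` agree at `0` and are interleaved with shift `ε` afterwards. -/
structure RankInterleaved (ε : ℝ) (M N : PersVec) : Prop where
  finrank_zero : finrank ℝ (M.obj 0) = finrank ℝ (N.obj 0)
  finrank_right_le : ∀ t, 0 ≤ t → finrank ℝ (N.obj (t + ε)) ≤ finrank ℝ (M.obj t)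
  finrank_left_le : ∀ t, 0 ≤ t → finrank ℝ (M.obj (t + ε)) ≤ finrank ℝ (N.obj t)

namespace IsBarcodeOf

variable {B : Barcode}

theorem isLeast_zero (hM : IsGrounded M) (hB : IsBarcodeOf B M) (i : B.ι) :
    IsLeast (B.bar i).carrier 0 :=
  ⟨(hB.alive_zero hM).ge (Set.mem_univ i), fun _ => hB.nonneg hM⟩

theorem exists_equiv_antitone_snd_endpoints (hM : IsGrounded M) (hB : IsBarcodeOf B M) :
    ∃ e : Fin (finrank ℝ (M.obj 0)) ≃ B.ι, Antitone fun k => (B.bar (e k)).endpoints.2 := by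
  have := hB.finite hM
  have hcard : finrank ℝ (M.obj 0) = Nat.card B.ι := by
    rw [← hB.card_alive, hB.alive_zero hM, Nat.card_univ]
  let e := (finCongr hcard).trans (Finite.equivFin B.ι).symm
  let death := fun k => OrderDual.toDual (B.bar (e k)).endpoints.2
  exact ⟨(Tuple.sort death).trans e, Tuple.monotone_sort death⟩

section Sorted

variable {m : ℕ} {e : Fin m ≃ B.ι} {k : Fin m} {t : ℝ}

theorem ncard_preimage_alive (hB : IsBarcodeOf B M) (e : Fin m ≃ B.ι) (t : ℝ) :
    (e ⁻¹' B.alive t).ncard = finrank ℝ (M.obj t) := by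
  rw [← hB.card_alive, Nat.card_coe_set_eq,
    Set.ncard_preimage_of_injective_subset_range e.injective]
  exact fun i _ => e.surjective i

theorem lt_finrank_of_lt_snd_endpoints (hM : IsGrounded M) (hB : IsBarcodeOf B M)
    (he : Antitone fun k => (B.bar (e k)).endpoints.2) (ht : 0 ≤ t)
    (hdeath : t < (B.bar (e k)).endpoints.2) : k < finrank ℝ (M.obj t) := by
  have halive : Set.Iic k ⊆ e ⁻¹' B.alive t := fun j hj =>
    RealInterval.mem_of_lt_snd_endpoints (hB.isLeast_zero hM _).1 ht (hdeath.trans_le (he hj))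
  calc (k : ℕ) < (Set.Iic k).ncard := by
        rw [← Finset.coe_Iic, Set.ncard_coe_finset, Fin.card_Iic]
        exact Nat.lt_succ_self k
    _ ≤ finrank ℝ (M.obj t) := hB.ncard_preimage_alive e t ▸ Set.ncard_le_ncard halive

theorem le_snd_endpoints_of_lt_finrank (hB : IsBarcodeOf B M)
    (he : Antitone fun k => (B.bar (e k)).endpoints.2) (hk : k < finrank ℝ (M.obj t)) :
    t ≤ (B.bar (e k)).endpoints.2 := by
  obtain ⟨j, hj, hkj⟩ : ∃ j ∈ e ⁻¹' B.alive t, k ≤ j := by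
    by_contra! h
    refine hk.not_ge ?_
    calc finrank ℝ (M.obj t) ≤ (Set.Iio k).ncard :=
          hB.ncard_preimage_alive e t ▸ Set.ncard_le_ncard h
      _ = k := by rw [← Finset.coe_Iio, Set.ncard_coe_finset, Fin.card_Iio]
  exact (RealInterval.coe_le_snd_endpoints hj).trans (he hkj)

end Sorted

theorem exists_equiv_endpoints_eq (hM : IsGrounded M) (hB : IsBarcodeOf B M) :
    ∃ e : Fin (finrank ℝ (M.obj 0)) ≃ B.ι, ∀ k, (B.bar (e k)).endpoints = (0, deathTime M k) := by
  obtain ⟨e, he⟩ := hB.exists_equiv_antitone_snd_endpoints hM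
  refine ⟨e, fun k => Prod.ext (RealInterval.fst_endpoints_of_isLeast (hB.isLeast_zero hM _))
    (le_antisymm (le_of_forall_lt fun c hc => ?_)
      (iSup₂_le fun t ht => hB.le_snd_endpoints_of_lt_finrank he ht))⟩
  obtain ⟨t, hct, htd⟩ := EReal.lt_iff_exists_real_btwn.1 hc
  refine hct.trans_le ?_
  rcases le_total 0 t with ht | ht
  · exact coe_le_deathTime (hB.lt_finrank_of_lt_snd_endpoints hM he ht htd)
  · exact (EReal.coe_nonpos.2 ht).trans (deathTime_nonneg k.2)

end IsBarcodeOf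

end DeathTime

/-! ## Convergence in bottleneck distance -/

section Convergence

open Module

theorem coordDist_self (x : EReal) : coordDist x x = 0 :=
  if_pos rfl

theorem coordDist_coe_le (x y : ℝ) : coordDist x y ≤ ENNReal.ofReal (Dist.dist x y) := by
  unfold coordDist
  split_ifs
  · exact zero_le
  · rw [← EReal.coe_sub, EReal.abs_def, Real.dist_eq]

theorem bottleneckDist_le {B B' : Barcode} (e : B.ι ≃ B'.ι) {r : ℝ≥0∞}
    (h : ∀ i, planeDist (B.bar i).endpoints (B'.bar (e i)).endpoints ≤ r) :
    bottleneckDist B B' ≤ r := by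
  refine (iInf_le _ (e.sumCongr (Equiv.refl ℝ))).trans (iSup_le ?_)
  rintro (i | x)
  · exact h i
  · change max (coordDist (x : EReal) x) (coordDist (x : EReal) x) ≤ r
    rw [coordDist_self, max_self]
    exact zero_le

theorem eq_top_of_top_le_add_coe {x : EReal} {r : ℝ} (h : ⊤ ≤ x + r) : x = ⊤ := by
  by_contra hx
  exact (EReal.add_lt_top hx (EReal.coe_ne_top r)).not_ge h

theorem exists_forall_coordDist_le_tsum {d : ℕ → EReal} (hnonneg : ∀ n, 0 ≤ d n) {ε : ℕ → ℝ}
    (hε : Summable ε) (hsucc : ∀ n, d (n + 1) ≤ d n + ε n) (hpred : ∀ n, d n ≤ d (n + 1) + ε n) :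
    ∃ D, 0 ≤ D ∧ ∀ n, coordDist (d n) D ≤ ENNReal.ofReal (∑' m, ε (n + m)) := by
  have htop (n : ℕ) : d n = ⊤ ↔ d 0 = ⊤ := by
    induction n with
    | zero => exact Iff.rfl
    | succ n ih => exact Iff.trans ⟨fun h => eq_top_of_top_le_add_coe (h.ge.trans (hsucc n)),
        fun h => eq_top_of_top_le_add_coe (h.ge.trans (hpred n))⟩ ih
  by_cases hd : d 0 = ⊤
  · refine ⟨⊤, le_top, fun n => ?_⟩
    rw [(htop n).2 hd, coordDist_self]
    exact zero_le
  lift d to ℕ → ℝ using fun n => ⟨mt (htop n).1 hd, (EReal.bot_lt_zero.trans_le (hnonneg n)).ne'⟩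
  have hdist (n : ℕ) : Dist.dist (d n) (d n.succ) ≤ ε n := by
    have hsucc := hsucc n
    have hpred := hpred n
    rw [← EReal.coe_add, EReal.coe_le_coe_iff] at hsucc hpred
    exact abs_sub_le_iff.2 ⟨sub_le_iff_le_add'.2 hpred, sub_le_iff_le_add'.2 hsucc⟩
  obtain ⟨D, hD⟩ := cauchySeq_tendsto_of_complete (cauchySeq_of_dist_le_of_summable ε hdist hε)
  exact ⟨D, ge_of_tendsto' ((continuous_coe_real_ereal.tendsto D).comp hD) hnonneg, fun n =>
    (coordDist_coe_le _ _).trans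
      (ENNReal.ofReal_le_ofReal (dist_le_tsum_of_dist_le_of_tendsto ε hdist hε hD n))⟩

/-- The interval of the nonnegative reals that are at most `D`. -/
def RealInterval.upTo (D : EReal) (hD : 0 ≤ D) : RealInterval where
  carrier := {t | 0 ≤ t ∧ (t : EReal) ≤ D}
  nonempty := ⟨0, le_rfl, hD⟩
  ordConnected := ⟨fun _ hs _ ht _ hu =>
    ⟨hs.1.trans hu.1, (EReal.coe_le_coe_iff.2 hu.2).trans ht.2⟩⟩

theorem RealInterval.endpoints_upTo (D : EReal) (hD : 0 ≤ D) :
    (upTo D hD).endpoints = (0, D) := by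
  have hzero : IsLeast (upTo D hD).carrier 0 := ⟨⟨le_rfl, hD⟩, fun _ ht => ht.1⟩
  refine Prod.ext (fst_endpoints_of_isLeast hzero)
    (le_antisymm (sSup_le ?_) (le_of_forall_lt fun c hc => ?_))
  · rintro _ ⟨t, ht, rfl⟩
    exact ht.2
  · rcases lt_or_ge c 0 with hneg | hnonneg
    · exact hneg.trans_le (coe_le_snd_endpoints hzero.1)
    · obtain ⟨t, hct, htD⟩ := EReal.lt_iff_exists_real_btwn.1 hc
      exact hct.trans_le (coe_le_snd_endpoints (I := upTo D hD)
        ⟨EReal.coe_nonneg.1 (hnonneg.trans hct.le), htD.le⟩)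

theorem exists_barcode_tendsto_bottleneckDist {M : ℕ → PersVec} (hM : ∀ n, IsGrounded (M n))
    {ε : ℕ → ℝ} (hε : Summable ε) (hrank : ∀ n, RankInterleaved (ε n) (M n) (M (n + 1))) :
    ∃ L : Barcode, Finite L.ι ∧ ∀ B : ℕ → Barcode, (∀ n, IsBarcodeOf (B n) (M n)) →
      Tendsto (fun n => bottleneckDist (B n) L) atTop (𝓝 0) := by
  obtain ⟨r, hr⟩ : ∃ r, ∀ n, finrank ℝ ((M n).obj 0) = r := by
    refine ⟨finrank ℝ ((M 0).obj 0), fun n => ?_⟩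
    induction n with
    | zero => rfl
    | succ n ih => exact (hrank n).finrank_zero.symm.trans ih
  have hlt (n : ℕ) (k : Fin r) : k < finrank ℝ ((M n).obj 0) := k.2.trans_eq (hr n).symm
  choose D hD₀ hD using fun k : Fin r =>
    exists_forall_coordDist_le_tsum (d := fun n => deathTime (M n) k)
      (fun n => deathTime_nonneg (hlt n k)) hε
      (fun n => deathTime_le_add (hlt n k) (hrank n).finrank_right_le)
      (fun n => deathTime_le_add (hlt (n + 1) k) (hrank n).finrank_left_le)
  refine ⟨⟨Fin r, fun k => .upTo (D k) (hD₀ k)⟩, inferInstanceAs (Finite (Fin r)), fun B hB => ?_⟩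
  have htail : Tendsto (fun n => ENNReal.ofReal (∑' m, ε (n + m))) atTop (𝓝 0) := by
    simpa only [add_comm, ENNReal.ofReal_zero] using
      ENNReal.tendsto_ofReal (tendsto_sum_nat_add ε)
  refine tendsto_of_tendsto_of_tendsto_of_le_of_le tendsto_const_nhds htail
    (fun _ => zero_le) fun n => ?_
  obtain ⟨e, he⟩ := (hB n).exists_equiv_endpoints_eq (hM n)
  refine bottleneckDist_le (e.symm.trans (finCongr (hr n))) fun i => ?_
  obtain ⟨k, rfl⟩ := e.surjective i
  rw [Equiv.trans_apply, Equiv.symm_apply_apply, RealInterval.endpoints_upTo, he, planeDist,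
    coordDist_self]
  exact max_le zero_le (hD (finCongr (hr n) k) n)

end Convergence

/-! ## Functoriality of the regular path complex -/

section RegularPathComplex

variable {V W : Type} {p : ℕ}

/-- The elementary path `v₀ … v_p` as a regular chain: it is `0` if `v` is not regular. -/
def regularPath (v : Fin (p + 1) → V) : Elem V p := regularProj V p (elemBasis V p v)

theorem regularPath_of_isRegular {v : Fin (p + 1) → V} (hv : IsRegular v) :
    regularPath v = elemBasis V p v := by
  rw [regularPath, regularProj, Module.Basis.constr_basis, if_pos hv]

theorem regularPath_of_not_isRegular {v : Fin (p + 1) → V} (hv : ¬ IsRegular v) :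
    regularPath v = 0 := by
  rw [regularPath, regularProj, Module.Basis.constr_basis, if_neg hv]

theorem boundary_elemBasis (v : Fin (p + 2) → V) :
    boundary V p (elemBasis V (p + 1) v) =
      ∑ i : Fin (p + 2), (-1 : ℝ) ^ (i : ℕ) • regularPath (v ∘ i.succAbove) := by
  rw [boundary, LinearMap.comp_apply, nonregularBoundary, Module.Basis.constr_basis]
  simp only [map_sum, map_smul, regularPath]

theorem comp_succAbove_succ_eq_castSucc {v : Fin (p + 2) → V} {k : Fin (p + 1)}
    (hk : v k.castSucc = v k.succ) : v ∘ k.succ.succAbove = v ∘ k.castSucc.succAbove := by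
  funext j
  simp only [Function.comp_apply]
  rcases lt_trichotomy j k with hjk | rfl | hkj
  · rw [Fin.succAbove_succ_of_le _ _ hjk.le, Fin.succAbove_castSucc_of_lt _ _ hjk]
  · rw [Fin.succAbove_succ_of_le _ _ le_rfl, Fin.succAbove_castSucc_of_le _ _ le_rfl, hk]
  · rw [Fin.succAbove_succ_of_lt _ _ hkj, Fin.succAbove_castSucc_of_le _ _ hkj.le]

theorem not_isRegular_comp_succAbove {v : Fin (p + 2) → V} {k : Fin (p + 1)}
    (hk : v k.castSucc = v k.succ) {i : Fin (p + 2)} (hi : i ≠ k.castSucc) (hi' : i ≠ k.succ) :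
    ¬ IsRegular (v ∘ i.succAbove) := by
  suffices h : ∃ j : Fin p, i.succAbove j.castSucc = k.castSucc ∧ i.succAbove j.succ = k.succ by
    obtain ⟨j, hj, hj'⟩ := h
    intro hreg
    exact hreg j (by simp only [Function.comp_apply, hj, hj', hk])
  rcases lt_or_gt_of_ne hi with hlt | hgt
  · obtain ⟨j, rfl⟩ := Fin.exists_succ_eq.2 (Fin.castSucc_pos_iff.1 (i.zero_le.trans_lt hlt)).ne'
    have hle : i ≤ j.castSucc.castSucc := Fin.le_castSucc_iff.2 (by simpa using hlt)
    exact ⟨j, by rw [Fin.succAbove_of_le_castSucc _ _ hle, Fin.succ_castSucc],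
      Fin.succAbove_of_le_castSucc _ _ hlt.le⟩
  · have hlt : k.succ < i := lt_of_le_of_ne (Fin.castSucc_lt_iff_succ_le.1 hgt) hi'.symm
    obtain ⟨j, rfl⟩ := Fin.exists_castSucc_eq.2
      (Fin.succ_lt_succ_iff.1 (hlt.trans_le i.le_last : k.succ < (Fin.last p).succ)).ne
    exact ⟨j, Fin.succAbove_of_succ_le _ _ hlt.le,
      by rw [Fin.succAbove_of_castSucc_lt _ _ (by simpa using hlt), Fin.succ_castSucc]⟩

theorem boundary_regularPath (v : Fin (p + 2) → V) :
    boundary V p (regularPath v) =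
      ∑ i : Fin (p + 2), (-1 : ℝ) ^ (i : ℕ) • regularPath (v ∘ i.succAbove) := by
  by_cases hv : IsRegular v
  · rw [regularPath_of_isRegular hv, boundary_elemBasis]
  · obtain ⟨k, hk⟩ := not_forall_not.1 hv
    rw [regularPath_of_not_isRegular hv, map_zero,
      Finset.sum_eq_add k.castSucc k.succ k.castSucc_lt_succ.ne
        (fun i _ hi => by
          rw [regularPath_of_not_isRegular (not_isRegular_comp_succAbove hk hi.1 hi.2), smul_zero])
        (by simp) (by simp),
      comp_succAbove_succ_eq_castSucc hk, Fin.val_castSucc, Fin.val_succ, pow_succ, ← add_smul]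
    simp

/-- The chain map induced by a map of vertices; it sends a path whose image is not regular
to `0`. -/
def chainMap (f : V → W) : Elem V p →ₗ[ℝ] Elem W p :=
  (elemBasis V p).constr ℝ fun v => regularPath (f ∘ v)

theorem chainMap_elemBasis (f : V → W) (v : Fin (p + 1) → V) :
    chainMap f (elemBasis V p v) = regularPath (f ∘ v) :=
  Module.Basis.constr_basis _ _ _ _

theorem chainMap_regularPath (f : V → W) (v : Fin (p + 1) → V) :
    chainMap f (regularPath v) = regularPath (f ∘ v) := by
  by_cases hv : IsRegular v
  · rw [regularPath_of_isRegular hv, chainMap_elemBasis]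
  · have hfv : ¬ IsRegular (f ∘ v) := fun h => hv fun i hi => h i (congrArg f hi)
    rw [regularPath_of_not_isRegular hv, regularPath_of_not_isRegular hfv, map_zero]

theorem boundary_chainMap (f : V → W) (x : Elem V (p + 1)) :
    boundary W p (chainMap f x) = chainMap f (boundary V p x) := by
  suffices h : boundary W p ∘ₗ chainMap f = chainMap f ∘ₗ boundary V p from
    LinearMap.congr_fun h x
  refine (elemBasis V (p + 1)).ext fun v => ?_
  simp only [LinearMap.comp_apply, chainMap_elemBasis, boundary_regularPath, boundary_elemBasis,
    map_sum, map_smul, chainMap_regularPath, Function.comp_assoc]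

theorem regularPath_mem_allowed {D : Digraph V} {v : Fin (p + 1) → V}
    (hv : ∀ i : Fin p, Relation.ReflGen D.Adj (v i.castSucc) (v i.succ)) :
    regularPath v ∈ allowed D p := by
  by_cases hreg : IsRegular v
  · rw [regularPath_of_isRegular hreg]
    exact Submodule.subset_span
      ⟨v, fun i => ((Relation.reflGen_iff _ _ _).1 (hv i)).resolve_left (hreg i).symm, rfl⟩
  · rw [regularPath_of_not_isRegular hreg]
    exact Submodule.zero_mem _

/-- A morphism of digraphs in the sense of path homology: edges go to edges or are collapsed to
vertices. -/
def IsDigraphMap (D : Digraph V) (D' : Digraph W) (f : V → W) : Prop :=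
  ∀ ⦃a b⦄, D.Adj a b → Relation.ReflGen D'.Adj (f a) (f b)

theorem IsDigraphMap.chainMap_mem_allowed {D : Digraph V} {D' : Digraph W} {f : V → W}
    (hf : IsDigraphMap D D' f) {x : Elem V p} (hx : x ∈ allowed D p) :
    chainMap f x ∈ allowed D' p := by
  suffices h : allowed D p ≤ (allowed D' p).comap (chainMap f) from h hx
  refine Submodule.span_le.2 ?_
  rintro _ ⟨v, hv, rfl⟩
  rw [SetLike.mem_coe, Submodule.mem_comap, chainMap_elemBasis]
  exact regularPath_mem_allowed fun i => hf (hv i)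

theorem IsDigraphMap.chainMap_mem_Omega {D : Digraph V} {D' : Digraph W} {f : V → W}
    (hf : IsDigraphMap D D' f) :
    ∀ {p : ℕ} {x : Elem V p}, x ∈ Omega D p → chainMap f x ∈ Omega D' p
  | 0, _, hx => hf.chainMap_mem_allowed hx
  | _ + 1, _, hx => ⟨hf.chainMap_mem_allowed hx.1, by
      rw [SetLike.mem_coe, Submodule.mem_comap, boundary_chainMap]
      exact hf.chainMap_mem_allowed hx.2⟩

/-- The vertex `a` as a `0`-chain. -/
def vertex (a : V) : Elem V 0 := regularPath ![a]

/-- The `1`-chain `ab`, which is `0` if `a = b`. -/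
def edge (a b : V) : Elem V 1 := regularPath ![a, b]

/-- The `2`-chain `abc`, which is `0` if `a = b` or `b = c`. -/
def triangle (a b c : V) : Elem V 2 := regularPath ![a, b, c]

theorem edge_self (a : V) : edge a a = 0 :=
  regularPath_of_not_isRegular fun h => h 0 rfl

theorem vertex_eq_elemBasis (a : V) : vertex a = elemBasis V 0 ![a] :=
  regularPath_of_isRegular fun i => i.elim0

theorem edge_of_ne {a b : V} (h : a ≠ b) : edge a b = elemBasis V 1 ![a, b] :=
  regularPath_of_isRegular fun i => by fin_cases i; exact h

theorem chainMap_vertex (f : V → W) (a : V) : chainMap f (vertex a) = vertex (f a) :=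
  (chainMap_regularPath f _).trans (congrArg regularPath (FinVec.etaExpand_eq _).symm)

theorem chainMap_edge (f : V → W) (a b : V) : chainMap f (edge a b) = edge (f a) (f b) :=
  (chainMap_regularPath f _).trans (congrArg regularPath (FinVec.etaExpand_eq _).symm)

theorem boundary_edge (a b : V) : boundary V 0 (edge a b) = vertex b - vertex a := by
  rw [edge, boundary_regularPath, Fin.sum_univ_two, sub_eq_add_neg]
  simp only [Fin.val_zero, Fin.val_one, pow_zero, pow_one, one_smul, neg_one_smul]
  congr! 2
  congr 1
  funext i
  fin_cases i
  rfl

theorem boundary_triangle (a b c : V) :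
    boundary V 1 (triangle a b c) = edge b c - edge a c + edge a b := by
  rw [triangle, boundary_regularPath, Fin.sum_univ_three, sub_eq_add_neg]
  simp only [Fin.val_zero, Fin.val_one, Fin.val_two, pow_zero, pow_one, neg_one_sq, one_smul,
    neg_one_smul]
  congr! 3 <;> (congr 1; funext i; fin_cases i <;> rfl)

theorem edge_mem_allowed {D : Digraph V} {a b : V} (h : Relation.ReflGen D.Adj a b) :
    edge a b ∈ allowed D 1 :=
  regularPath_mem_allowed fun i => by fin_cases i; exact h

theorem triangle_mem_Omega {D : Digraph V} {a b c : V} (hab : Relation.ReflGen D.Adj a b)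
    (hbc : Relation.ReflGen D.Adj b c) (hac : Relation.ReflGen D.Adj a c) :
    triangle a b c ∈ Omega D 2 := by
  refine ⟨regularPath_mem_allowed fun i => ?_, ?_⟩
  · fin_cases i
    exacts [hab, hbc]
  · rw [SetLike.mem_coe, Submodule.mem_comap, boundary_triangle]
    exact add_mem (sub_mem (edge_mem_allowed hbc) (edge_mem_allowed hac)) (edge_mem_allowed hab)

theorem allowed_one_le {D : Digraph V} {S : Submodule ℝ (Elem V 1)} (hD : ∀ v, ¬ D.Adj v v)
    (hS : ∀ ⦃a b⦄, D.Adj a b → edge a b ∈ S) : allowed D 1 ≤ S := by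
  refine Submodule.span_le.2 ?_
  rintro _ ⟨v, hv, rfl⟩
  have hadj : D.Adj (v 0) (v 1) := hv 0
  have hne : v 0 ≠ v 1 := fun heq => hD (v 1) (by rwa [heq] at hadj)
  rw [SetLike.mem_coe, show v = ![v 0, v 1] from (FinVec.etaExpand_eq v).symm, ← edge_of_ne hne]
  exact hS hadj

theorem allowed_zero (D : Digraph V) : allowed D 0 = ⊤ := by
  have huniv : {v : Fin 1 → V | IsAllowed D v} = Set.univ :=
    Set.eq_univ_of_forall fun _ i => i.elim0
  rw [allowed, huniv, Set.image_univ, (elemBasis V 0).span_eq]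

theorem Omega_one (D : Digraph V) : Omega D 1 = allowed D 1 := by
  rw [Omega, allowed_zero, Submodule.comap_top, inf_top_eq]

end RegularPathComplex

/-! ## The shortest-path quasimetric -/

namespace WDigraph

instance (G : WDigraph) : Finite G.V := G.finite

section ShortestPaths

variable {G : WDigraph}

theorem Trail.length_nonneg : ∀ {a b : G.V} (p : G.Trail a b), 0 ≤ p.length
  | _, _, .nil _ => le_rfl
  | _, _, .cons _ p => add_nonneg (G.weight_pos _).le p.length_nonneg

theorem Trail.head?_support : ∀ {a b : G.V} (p : G.Trail a b), p.support.head? = some a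
  | _, _, .nil _ => rfl
  | _, _, .cons _ _ => rfl

theorem Trail.support_ne_nil {a b : G.V} (p : G.Trail a b) : p.support ≠ [] := fun h => by
  simpa [h] using p.head?_support

theorem Trail.support_injective : ∀ {a b : G.V}, Function.Injective (@Trail.support G a b)
  | _, _, .nil _, .nil _, _ => rfl
  | _, _, .nil _, .cons _ q, h => (q.support_ne_nil (List.tail_eq_of_cons_eq h).symm).elim
  | _, _, .cons _ p, .nil _, h => (p.support_ne_nil (List.tail_eq_of_cons_eq h)).elim
  | _, _, .cons (b := b) _ p, .cons (b := b') _ q, h => by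
    have htail : p.support = q.support := List.tail_eq_of_cons_eq h
    obtain rfl : b = b' := by
      simpa only [p.head?_support, q.head?_support, Option.some_inj] using
        congrArg List.head? htail
    rw [Trail.support_injective htail]

instance finite_path (a b : G.V) : Finite {p : G.Trail a b // p.IsPath} := by
  classical
  have := Fintype.ofFinite G.V
  exact Finite.of_injective (β := {l : List G.V // l.Nodup}) (fun p => ⟨p.1.support, p.2⟩)
    fun p q h => Subtype.ext (Trail.support_injective (congrArg Subtype.val h))

theorem Trail.exists_suffix : ∀ {a b c : G.V} (p : G.Trail b c), a ∈ p.support →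
    ∃ q : G.Trail a c, q.length ≤ p.length ∧ q.support <:+ p.support
  | a, _, _, .nil b, ha => by
    obtain rfl : a = b := List.mem_singleton.1 ha
    exact ⟨.nil a, le_rfl, List.suffix_rfl⟩
  | a, b, _, .cons e p, ha => by
    rcases List.mem_cons.1 ha with rfl | ha
    · exact ⟨.cons e p, le_rfl, List.suffix_rfl⟩
    · obtain ⟨q, hlength, hsuffix⟩ := p.exists_suffix ha
      exact ⟨q, hlength.trans (le_add_of_nonneg_left (G.weight_pos _).le),
        hsuffix.trans (List.suffix_cons _ _)⟩

theorem Trail.exists_isPath : ∀ {a b : G.V} (p : G.Trail a b),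
    ∃ q : G.Trail a b, q.IsPath ∧ q.length ≤ p.length
  | _, _, .nil a => ⟨.nil a, List.nodup_singleton a, le_rfl⟩
  | a, _, .cons e p => by
    obtain ⟨q, hq, hlength⟩ := p.exists_isPath
    by_cases ha : a ∈ q.support
    · obtain ⟨r, hr, hsuffix⟩ := q.exists_suffix ha
      exact ⟨r, hq.sublist hsuffix.sublist,
        hr.trans (hlength.trans (le_add_of_nonneg_left (G.weight_pos _).le))⟩
    · exact ⟨.cons e q, List.nodup_cons.2 ⟨ha, hq⟩, add_le_add_right hlength _⟩

theorem dist_le_iff {a b : G.V} {t : ℝ} :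
    G.dist a b ≤ (t : EReal) ↔ ∃ p : G.Trail a b, p.length ≤ t := by
  constructor
  · intro h
    cases isEmpty_or_nonempty {p : G.Trail a b // p.IsPath} with
    | inl _ =>
      rw [dist, iInf_of_empty, top_le_iff] at h
      exact (EReal.coe_ne_top _ h).elim
    | inr _ =>
      obtain ⟨p, hp⟩ := exists_eq_ciInf_of_finite
        (f := fun p : {p : G.Trail a b // p.IsPath} => ((p.1.length : ℝ) : EReal))
      exact ⟨p.1, EReal.coe_le_coe_iff.1 (hp.le.trans h)⟩
  · rintro ⟨p, hp⟩
    obtain ⟨q, hq, hlength⟩ := p.exists_isPath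
    exact (iInf_le _ (⟨q, hq⟩ : {p : G.Trail a b // p.IsPath})).trans
      (EReal.coe_le_coe_iff.2 (hlength.trans hp))

theorem reflGen_filtration_adj {a b : G.V} {t : ℝ} (p : G.Trail a b) (hp : p.length ≤ t) :
    Relation.ReflGen (G.filtration t).Adj a b :=
  (Relation.reflGen_iff _ _ _).2 <| or_iff_not_imp_left.2 fun hab =>
    ⟨Ne.symm hab, dist_le_iff.2 ⟨p, hp⟩⟩

theorem not_filtration_zero_adj (a b : G.V) : ¬ (G.filtration 0).Adj a b := by
  rintro ⟨hab, hdist⟩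
  obtain ⟨p, hp⟩ := dist_le_iff.1 hdist
  cases p with
  | nil => exact hab rfl
  | cons e p => exact (add_pos_of_pos_of_nonneg (G.weight_pos _) p.length_nonneg).not_ge hp

theorem isDigraphMap_filtration {G' : WDigraph} {f : G.V → G'.V} {c : ℝ}
    (hf : ∀ ⦃a b⦄ (p : G.Trail a b), ∃ q : G'.Trail (f a) (f b), q.length ≤ p.length + c)
    (t : ℝ) : IsDigraphMap (G.filtration t) (G'.filtration (t + c)) f := by
  rintro a b ⟨-, hdist⟩
  obtain ⟨p, hp⟩ := dist_le_iff.1 hdist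
  obtain ⟨q, hq⟩ := hf p
  exact reflGen_filtration_adj q (by linarith)

end ShortestPaths

end WDigraph

/-! ## Grounded homology as a quotient of the cycles of the digraph -/

instance (V : Type) [Finite V] (p : ℕ) : Module.Finite ℝ (Elem V p) :=
  Module.Finite.of_basis (elemBasis V p)

namespace WDigraph

section GroundedHomology

variable {G G' : WDigraph} {s t : ℝ}

theorem mem_groundedCycles (ht : 0 ≤ t) {x : Elem G.V 1} :
    x ∈ G.groundedCycles t ↔
      x ∈ allowed (G.graph ⊔ G.filtration t) 1 ∧ boundary G.V 0 x = 0 := by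
  rw [groundedCycles, groundedChains, if_neg ht.not_gt, if_pos le_rfl, Omega_one]
  rfl

theorem mem_groundedBoundaries (ht : 0 ≤ t) {x : Elem G.V 1} :
    x ∈ G.groundedBoundaries t ↔ ∃ y ∈ Omega (G.filtration t) 2, boundary G.V 1 y = x := by
  rw [groundedBoundaries, groundedChains, if_neg ht.not_gt, if_neg (by norm_num)]
  rfl

theorem mem_groundedCycles_zero {x : Elem G.V 1} :
    x ∈ G.groundedCycles 0 ↔ x ∈ allowed G.graph 1 ∧ boundary G.V 0 x = 0 := by
  have hgraph : G.graph ⊔ G.filtration 0 = G.graph :=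
    sup_eq_left.2 fun a b hab => (not_filtration_zero_adj a b hab).elim
  rw [mem_groundedCycles le_rfl, hgraph]

theorem groundedBoundaries_zero (G : WDigraph) : G.groundedBoundaries 0 = ⊥ := by
  refine (Submodule.eq_bot_iff _).2 fun x hx => ?_
  obtain ⟨y, hy, rfl⟩ := (mem_groundedBoundaries le_rfl).1 hx
  have hbot : allowed (G.filtration 0) 2 ≤ ⊥ := by
    refine Submodule.span_le.2 ?_
    rintro _ ⟨v, hv, rfl⟩
    exact (not_filtration_zero_adj _ _ (hv 0)).elim
  rw [(Submodule.mem_bot ℝ).1 (hbot hy.1), map_zero]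

theorem chainMap_mem_groundedBoundaries {f : G.V → G'.V}
    (hf : IsDigraphMap (G.filtration s) (G'.filtration t) f) (hs : 0 ≤ s) (ht : 0 ≤ t)
    {x : Elem G.V 1} (hx : x ∈ G.groundedBoundaries s) :
    chainMap f x ∈ G'.groundedBoundaries t := by
  obtain ⟨y, hy, rfl⟩ := (mem_groundedBoundaries hs).1 hx
  exact (mem_groundedBoundaries ht).2 ⟨_, hf.chainMap_mem_Omega hy, boundary_chainMap f y⟩

theorem subsingleton_groundedHomology (ht : t < 0) : Subsingleton (G.groundedHomology t) := by
  have hbot : G.groundedCycles t = ⊥ := by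
    rw [groundedCycles, groundedChains, if_pos ht, bot_inf_eq]
  have : Subsingleton (G.groundedCycles t) := hbot ▸ inferInstance
  infer_instance

theorem edge_mem_sup_of_trail (ht : 0 ≤ t) : ∀ {a b : G.V} (p : G.Trail a b), p.length ≤ t →
    edge a b ∈ allowed G.graph 1 ⊔ G.groundedBoundaries t
  | _, _, .nil a, _ => by
    rw [edge_self]
    exact Submodule.zero_mem _
  | a, b, .cons (b := c) e p, hep => by
    have hp : p.length ≤ t := (le_add_of_nonneg_left (G.weight_pos _).le).trans hep
    have he : (Trail.cons e (.nil c)).length ≤ t :=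
      (add_le_add_right p.length_nonneg (G.weight ⟨(a, c), e⟩)).trans hep
    have hac : edge a c ∈ allowed G.graph 1 ⊔ G.groundedBoundaries t :=
      Submodule.mem_sup_left (edge_mem_allowed (.single e))
    have hcb : edge c b ∈ allowed G.graph 1 ⊔ G.groundedBoundaries t :=
      edge_mem_sup_of_trail ht p hp
    have hacb : boundary G.V 1 (triangle a c b) ∈ allowed G.graph 1 ⊔ G.groundedBoundaries t :=
      Submodule.mem_sup_right ((mem_groundedBoundaries ht).2 ⟨_, triangle_mem_Omega
        (reflGen_filtration_adj _ he) (reflGen_filtration_adj p hp)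
        (reflGen_filtration_adj _ hep), rfl⟩)
    have hab : edge a b = edge a c + edge c b - boundary G.V 1 (triangle a c b) := by
      rw [boundary_triangle]
      abel
    rw [hab]
    exact sub_mem (add_mem hac hcb) hacb

theorem allowed_sup_filtration_le (ht : 0 ≤ t) : allowed (G.graph ⊔ G.filtration t) 1 ≤
    allowed G.graph 1 ⊔ G.groundedBoundaries t := by
  refine allowed_one_le ?_ ?_
  · rintro v (hv | hv)
    · exact G.loopless v hv
    · exact hv.1 rfl
  · rintro a b (hab | hab)
    · exact Submodule.mem_sup_left (edge_mem_allowed (.single hab))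
    · obtain ⟨p, hp⟩ := dist_le_iff.1 hab.2
      exact edge_mem_sup_of_trail ht p hp

/-- The class in `H₁(G, t)` of a cycle of `G`. -/
def groundedClass (G : WDigraph) (ht : 0 ≤ t) : G.groundedCycles 0 →ₗ[ℝ] G.groundedHomology t :=
  Submodule.mkQ _ ∘ₗ Submodule.inclusion (G.groundedCycles_mono ht)

theorem groundedClass_surjective (ht : 0 ≤ t) : Function.Surjective (G.groundedClass ht) := by
  intro y
  obtain ⟨⟨x, hx⟩, rfl⟩ := Submodule.mkQ_surjective _ y
  obtain ⟨hallowed, hcycle⟩ := (mem_groundedCycles ht).1 hx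
  obtain ⟨z, hz, y, hy, rfl⟩ := Submodule.mem_sup.1 (allowed_sup_filtration_le ht hallowed)
  have hy₀ : boundary G.V 0 y = 0 := ((mem_groundedCycles ht).1 (G.groundedBoundaries_le t hy)).2
  have hz₀ : z ∈ G.groundedCycles 0 :=
    mem_groundedCycles_zero.2 ⟨hz, by rwa [map_add, hy₀, add_zero] at hcycle⟩
  refine ⟨⟨z, hz₀⟩, (Submodule.Quotient.eq _).2 ?_⟩
  change z - (z + y) ∈ G.groundedBoundaries t
  rw [sub_add_cancel_left]
  exact Submodule.neg_mem _ hy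

theorem groundedClass_eq_zero_iff (ht : 0 ≤ t) {x : G.groundedCycles 0} :
    G.groundedClass ht x = 0 ↔ (x : Elem G.V 1) ∈ G.groundedBoundaries t := by
  rw [groundedClass, LinearMap.comp_apply, Submodule.mkQ_apply, Submodule.Quotient.mk_eq_zero,
    Submodule.submoduleOf, Submodule.mem_comap, Submodule.subtype_apply, Submodule.coe_inclusion]

theorem groundedHomologyMap_surjective (ht : 0 ≤ t) :
    Function.Surjective (G.groundedHomologyMap ht) :=
  Function.Surjective.of_comp (g := Submodule.mkQ _) (groundedClass_surjective ht)

theorem finrank_groundedHomology_le (hs : 0 ≤ s) (ht : 0 ≤ t)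
    {f : Elem G.V 1 →ₗ[ℝ] Elem G'.V 1} (hcycles : (G.groundedCycles 0).map f = G'.groundedCycles 0)
    (hboundaries : ∀ x ∈ G.groundedCycles 0, x ∈ G.groundedBoundaries s →
      f x ∈ G'.groundedBoundaries t) :
    Module.finrank ℝ (G'.groundedHomology t) ≤ Module.finrank ℝ (G.groundedHomology s) := by
  have hf : ∀ x ∈ G.groundedCycles 0, f x ∈ G'.groundedCycles 0 := fun x hx =>
    hcycles ▸ Submodule.mem_map_of_mem hx
  have hsurj : Function.Surjective (f.restrict hf) := fun ⟨y, hy⟩ => by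
    obtain ⟨x, hx, rfl⟩ := hcycles.ge hy
    exact ⟨⟨x, hx⟩, rfl⟩
  refine finrank_le_finrank_of_ker_le_ker (p := G.groundedClass hs)
    (q := G'.groundedClass ht ∘ₗ f.restrict hf) ((groundedClass_surjective ht).comp hsurj) ?_
  intro x hx
  exact (groundedClass_eq_zero_iff ht).2
    (hboundaries x x.2 ((groundedClass_eq_zero_iff hs).1 hx))

end GroundedHomology

end WDigraph

/-! ## Medial subdivision -/

namespace WDigraph

section Medial

variable {G : WDigraph}

/-- A vertex of `G`, as a vertex of the medial subdivision. -/
def old (a : G.V) : G.medial.V := (Sum.inl a : G.V ⊕ G.Edge)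

/-- The new vertex `v_e` on an edge `e`, as a vertex of the medial subdivision. -/
def mid (e : G.Edge) : G.medial.V := (Sum.inr e : G.V ⊕ G.Edge)

/-- The retraction of the medial subdivision that collapses the second half of each edge, so that
the first half becomes the whole edge. -/
def retract : G.medial.V → G.V := Sum.elim id fun e : G.Edge => e.1.2

/-- The distance along the edges from a vertex `x` to the vertex `old (retract x)`. -/
def retractLength : G.medial.V → ℝ := Sum.elim 0 fun e : G.Edge => G.weight e / 2

theorem adj_old_mid (e : G.Edge) : G.medial.graph.Adj (old e.1.1) (mid e) := rfl

theorem adj_mid_old (e : G.Edge) : G.medial.graph.Adj (mid e) (old e.1.2) := rfl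

theorem exists_of_medial_adj {x y : G.medial.V} (h : G.medial.graph.Adj x y) :
    ∃ e : G.Edge, (x = old e.1.1 ∧ y = mid e) ∨ (x = mid e ∧ y = old e.1.2) := by
  rcases x with a | e <;> rcases y with b | e'
  · exact (h : False).elim
  · obtain rfl : e'.1.1 = a := h
    exact ⟨e', .inl ⟨rfl, rfl⟩⟩
  · obtain rfl : e.1.2 = b := h
    exact ⟨e, .inr ⟨rfl, rfl⟩⟩
  · exact (h : False).elim

theorem exists_trail_old : ∀ {a b : G.V} (p : G.Trail a b),
    ∃ q : G.medial.Trail (old a) (old b), q.length = p.length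
  | _, _, .nil a => ⟨.nil (old a), rfl⟩
  | a, _, .cons (b := b) h p => by
    obtain ⟨q, hq⟩ := exists_trail_old p
    let e : G.Edge := ⟨(a, b), h⟩
    refine ⟨.cons (adj_old_mid e) (.cons (adj_mid_old e) q), ?_⟩
    change G.weight e / 2 + (G.weight e / 2 + q.length) = G.weight e + p.length
    rw [hq]
    ring

theorem exists_trail_retract : ∀ {x y : G.medial.V} (p : G.medial.Trail x y),
    ∃ q : G.Trail (retract x) (retract y),
      q.length + retractLength x = p.length + retractLength y
  | _, _, .nil x => ⟨.nil (retract x), rfl⟩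
  | _, y, .cons h p => by
    obtain ⟨q, hq⟩ := exists_trail_retract p
    obtain ⟨e, ⟨rfl, rfl⟩ | ⟨rfl, rfl⟩⟩ := exists_of_medial_adj h
    · change q.length + G.weight e / 2 = _ at hq
      refine ⟨.cons e.2 q, ?_⟩
      change G.weight e + q.length + 0 = G.weight e / 2 + p.length + _
      linarith
    · change q.length + 0 = _ at hq
      refine ⟨q, ?_⟩
      change q.length + G.weight e / 2 = G.weight e / 2 + p.length + _
      linarith

theorem isDigraphMap_filtration_old (t : ℝ) :
    IsDigraphMap (G.filtration t) (G.medial.filtration t) old := by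
  simpa only [add_zero] using isDigraphMap_filtration (c := 0)
    (fun a b p => (exists_trail_old p).imp fun q hq => by rw [hq, add_zero]) t

theorem isDigraphMap_filtration_retract {c : ℝ} (hc : 0 ≤ c) (hweight : ∀ e, G.weight e ≤ c)
    (t : ℝ) : IsDigraphMap (G.medial.filtration t) (G.filtration (t + c)) retract := by
  refine isDigraphMap_filtration (fun x y p => (exists_trail_retract p).imp fun q hq => ?_) t
  have hx : 0 ≤ retractLength x := by
    rcases x with a | e
    exacts [le_rfl, (half_pos (G.weight_pos e)).le]
  have hy : retractLength y ≤ c := by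
    rcases y with a | e
    exacts [hc, (half_le_self (G.weight_pos e).le).trans (hweight e)]
  linarith

theorem isDigraphMap_retract : IsDigraphMap G.medial.graph G.graph retract := by
  intro x y hxy
  obtain ⟨e, ⟨rfl, rfl⟩ | ⟨rfl, rfl⟩⟩ := exists_of_medial_adj hxy
  exacts [.single e.2, .refl]

open Classical in
/-- Subdivision of `1`-chains: `ab ↦ a v_e + v_e b` for an edge `e = (a, b)`. -/
def subdivide : Elem G.V 1 →ₗ[ℝ] Elem G.medial.V 1 :=
  (elemBasis G.V 1).constr ℝ fun v =>
    if h : G.graph.Adj (v 0) (v 1) then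
      edge (old (v 0)) (mid ⟨(v 0, v 1), h⟩) + edge (mid ⟨(v 0, v 1), h⟩) (old (v 1))
    else 0

theorem subdivide_edge (e : G.Edge) :
    subdivide (edge e.1.1 e.1.2) = edge (old e.1.1) (mid e) + edge (mid e) (old e.1.2) := by
  have hne : e.1.1 ≠ e.1.2 := fun h => G.loopless e.1.2 (by simpa only [h] using e.2)
  rw [edge_of_ne hne, subdivide, Module.Basis.constr_basis]
  exact dif_pos e.2

theorem subdivide_mem_allowed {x : Elem G.V 1} (hx : x ∈ allowed G.graph 1) :
    subdivide x ∈ allowed G.medial.graph 1 := by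
  suffices h : allowed G.graph 1 ≤ (allowed G.medial.graph 1).comap subdivide from h hx
  refine allowed_one_le G.loopless fun a b hab => ?_
  rw [Submodule.mem_comap, subdivide_edge ⟨(a, b), hab⟩]
  exact add_mem (edge_mem_allowed (.single (adj_old_mid _)))
    (edge_mem_allowed (.single (adj_mid_old _)))

theorem boundary_subdivide {x : Elem G.V 1} (hx : x ∈ allowed G.graph 1) :
    boundary G.medial.V 0 (subdivide x) = chainMap old (boundary G.V 0 x) := by
  suffices h : allowed G.graph 1 ≤
      LinearMap.eqLocus (boundary G.medial.V 0 ∘ₗ subdivide) (chainMap old ∘ₗ boundary G.V 0) from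
    h hx
  refine allowed_one_le G.loopless fun a b hab => ?_
  rw [LinearMap.mem_eqLocus, LinearMap.comp_apply, LinearMap.comp_apply,
    subdivide_edge ⟨(a, b), hab⟩]
  simp only [map_add, map_sub, boundary_edge, chainMap_vertex]
  abel

theorem chainMap_retract_subdivide {x : Elem G.V 1} (hx : x ∈ allowed G.graph 1) :
    chainMap retract (subdivide x) = x := by
  suffices h : allowed G.graph 1 ≤
      LinearMap.eqLocus (chainMap retract ∘ₗ subdivide) LinearMap.id from h hx
  refine allowed_one_le G.loopless fun a b hab => ?_
  rw [LinearMap.mem_eqLocus, LinearMap.comp_apply, subdivide_edge ⟨(a, b), hab⟩, map_add,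
    chainMap_edge, chainMap_edge]
  change edge a b + edge b b = edge a b
  rw [edge_self, add_zero]

/-- The chain homotopy from the identity to `subdivide ∘ chainMap retract`: it sends a vertex `x` to
the edge from `x` to `old (retract x)`. -/
def retractHomotopy : Elem G.medial.V 0 →ₗ[ℝ] Elem G.medial.V 1 :=
  (elemBasis G.medial.V 0).constr ℝ fun v => edge (v 0) (old (retract (v 0)))

theorem retractHomotopy_vertex (x : G.medial.V) :
    retractHomotopy (vertex x) = edge x (old (retract x)) := by
  rw [vertex_eq_elemBasis, retractHomotopy, Module.Basis.constr_basis]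
  rfl

theorem subdivide_chainMap_retract {x : Elem G.medial.V 1} (hx : x ∈ allowed G.medial.graph 1) :
    subdivide (chainMap retract x) = x + retractHomotopy (boundary G.medial.V 0 x) := by
  suffices h : allowed G.medial.graph 1 ≤ LinearMap.eqLocus (subdivide ∘ₗ chainMap retract)
      (LinearMap.id + retractHomotopy ∘ₗ boundary G.medial.V 0) from h hx
  refine allowed_one_le G.medial.loopless fun x y hxy => ?_
  rw [LinearMap.mem_eqLocus, LinearMap.comp_apply, LinearMap.add_apply, LinearMap.comp_apply,
    chainMap_edge, boundary_edge, map_sub, retractHomotopy_vertex, retractHomotopy_vertex]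
  obtain ⟨e, ⟨rfl, rfl⟩ | ⟨rfl, rfl⟩⟩ := exists_of_medial_adj hxy
  · change subdivide (edge e.1.1 e.1.2) = edge (old e.1.1) (mid e) +
      (edge (mid e) (old e.1.2) - edge (old e.1.1) (old e.1.1))
    rw [subdivide_edge, edge_self, sub_zero]
  · change subdivide (edge e.1.2 e.1.2) = edge (mid e) (old e.1.2) +
      (edge (old e.1.2) (old e.1.2) - edge (mid e) (old e.1.2))
    rw [edge_self, edge_self, map_zero, zero_sub, add_neg_cancel]

theorem subdivide_mem_groundedCycles {x : Elem G.V 1} (hx : x ∈ G.groundedCycles 0) :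
    subdivide x ∈ G.medial.groundedCycles 0 := by
  obtain ⟨hallowed, hcycle⟩ := mem_groundedCycles_zero.1 hx
  exact mem_groundedCycles_zero.2
    ⟨subdivide_mem_allowed hallowed, by rw [boundary_subdivide hallowed, hcycle, map_zero]⟩

theorem chainMap_retract_mem_groundedCycles {x : Elem G.medial.V 1}
    (hx : x ∈ G.medial.groundedCycles 0) : chainMap retract x ∈ G.groundedCycles 0 := by
  obtain ⟨hallowed, hcycle⟩ := mem_groundedCycles_zero.1 hx
  exact mem_groundedCycles_zero.2 ⟨isDigraphMap_retract.chainMap_mem_allowed hallowed,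
    by rw [boundary_chainMap, hcycle, map_zero]⟩

theorem map_subdivide_groundedCycles :
    (G.groundedCycles 0).map subdivide = G.medial.groundedCycles 0 := by
  refine le_antisymm (Submodule.map_le_iff_le_comap.2 fun x => subdivide_mem_groundedCycles) ?_
  intro x hx
  obtain ⟨hallowed, hcycle⟩ := mem_groundedCycles_zero.1 hx
  refine ⟨chainMap retract x, chainMap_retract_mem_groundedCycles hx, ?_⟩
  rw [subdivide_chainMap_retract hallowed, hcycle, map_zero, add_zero]

theorem map_chainMap_retract_groundedCycles :
    (G.medial.groundedCycles 0).map (chainMap retract) = G.groundedCycles 0 := by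
  refine le_antisymm
    (Submodule.map_le_iff_le_comap.2 fun x => chainMap_retract_mem_groundedCycles) ?_
  intro x hx
  exact ⟨subdivide x, subdivide_mem_groundedCycles hx,
    chainMap_retract_subdivide (mem_groundedCycles_zero.1 hx).1⟩

theorem subdivide_sub_chainMap_old_mem_groundedBoundaries {c : ℝ} (hc : 0 ≤ c)
    (hweight : ∀ e, G.weight e ≤ c) {x : Elem G.V 1} (hx : x ∈ allowed G.graph 1) :
    subdivide x - chainMap old x ∈ G.medial.groundedBoundaries c := by
  suffices h : allowed G.graph 1 ≤
      (G.medial.groundedBoundaries c).comap (subdivide - chainMap old) from h hx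
  refine allowed_one_le G.loopless fun a b hab => ?_
  let e : G.Edge := ⟨(a, b), hab⟩
  have hw : G.weight e ≤ c := hweight e
  have hw₀ : 0 < G.weight e := G.weight_pos e
  let second : G.medial.Trail (mid e) (old b) := .cons (adj_mid_old e) (.nil _)
  let first : G.medial.Trail (old a) (mid e) := .cons (adj_old_mid e) (.nil _)
  let whole : G.medial.Trail (old a) (old b) := .cons (adj_old_mid e) second
  have hfirst : first.length = G.weight e / 2 + 0 := rfl
  have hsecond : second.length = G.weight e / 2 + 0 := rfl
  have hwhole : whole.length = G.weight e / 2 + (G.weight e / 2 + 0) := rfl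
  refine (mem_groundedBoundaries hc).2 ⟨triangle (old a) (mid e) (old b), triangle_mem_Omega
    (reflGen_filtration_adj first (by linarith)) (reflGen_filtration_adj second (by linarith))
    (reflGen_filtration_adj whole (by linarith)), ?_⟩
  rw [boundary_triangle, LinearMap.sub_apply, subdivide_edge e, chainMap_edge]
  abel

theorem subdivide_mem_groundedBoundaries {c t : ℝ} (hc : 0 ≤ c) (ht : 0 ≤ t)
    (hweight : ∀ e, G.weight e ≤ c) {x : Elem G.V 1} (hallowed : x ∈ allowed G.graph 1)
    (hx : x ∈ G.groundedBoundaries t) : subdivide x ∈ G.medial.groundedBoundaries (t + c) := by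
  rw [← sub_add_cancel (subdivide x) (chainMap old x)]
  refine add_mem (G.medial.groundedBoundaries_mono (le_add_of_nonneg_left ht)
    (subdivide_sub_chainMap_old_mem_groundedBoundaries hc hweight hallowed)) ?_
  exact G.medial.groundedBoundaries_mono (le_add_of_nonneg_right hc)
    (chainMap_mem_groundedBoundaries (isDigraphMap_filtration_old t) ht ht hx)

end Medial

section Interleaving

variable {G : WDigraph}

theorem isGrounded_grpph (G : WDigraph) : IsGrounded G.grpph where
  subsingleton _ ht := subsingleton_groundedHomology ht
  finite := inferInstanceAs (Module.Finite ℝ (G.groundedHomology 0))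
  surjective _ ht := groundedHomologyMap_surjective ht

theorem finrank_groundedHomology_zero_medial :
    Module.finrank ℝ (G.groundedHomology 0) = Module.finrank ℝ (G.medial.groundedHomology 0) := by
  refine le_antisymm (finrank_groundedHomology_le le_rfl le_rfl map_chainMap_retract_groundedCycles
    fun x _ hx => ?_) (finrank_groundedHomology_le le_rfl le_rfl map_subdivide_groundedCycles
    fun x _ hx => ?_)
  all_goals
    rw [groundedBoundaries_zero, Submodule.mem_bot] at hx
    rw [hx, map_zero]
    exact zero_mem _

theorem rankInterleaved_grpph_medial {c : ℝ} (hc : 0 ≤ c) (hweight : ∀ e, G.weight e ≤ c) :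
    RankInterleaved c G.grpph G.medial.grpph where
  finrank_zero := finrank_groundedHomology_zero_medial
  finrank_right_le _ ht := finrank_groundedHomology_le ht (add_nonneg ht hc)
    map_subdivide_groundedCycles fun _ hcycle =>
      subdivide_mem_groundedBoundaries hc ht hweight (mem_groundedCycles_zero.1 hcycle).1
  finrank_left_le t ht := finrank_groundedHomology_le ht (add_nonneg ht hc)
    map_chainMap_retract_groundedCycles fun _ _ =>
      chainMap_mem_groundedBoundaries (isDigraphMap_filtration_retract hc hweight t) ht
        (add_nonneg ht hc)

theorem exists_weight_le (G : WDigraph) : ∃ c : ℝ, 0 ≤ c ∧ ∀ e, G.weight e ≤ c := by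
  obtain ⟨c, hc⟩ := (Set.finite_range G.weight).bddAbove
  exact ⟨max 0 c, le_max_left _ _, fun e => (hc ⟨e, rfl⟩).trans (le_max_right _ _)⟩

theorem medial_weight_le {c : ℝ} (hc : ∀ e, G.weight e ≤ c) (e : G.medial.Edge) :
    G.medial.weight e ≤ c / 2 := by
  obtain ⟨⟨a | e, b | e'⟩, h⟩ := e
  · exact (h : False).elim
  · exact div_le_div_of_nonneg_right (hc e') zero_le_two
  · exact div_le_div_of_nonneg_right (hc e) zero_le_two
  · exact (h : False).elim

theorem iteratedMedial_weight_le {c : ℝ} (hc : ∀ e, G.weight e ≤ c) (n : ℕ) :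
    ∀ e, (G.iteratedMedial n).weight e ≤ c / 2 ^ n := by
  induction n with
  | zero => exact fun e => (hc e).trans_eq (by rw [pow_zero, div_one])
  | succ n ih => exact fun e => (medial_weight_le ih e).trans_eq (by rw [pow_succ, ← div_div])

end Interleaving

end WDigraph

end GrPPH

end

theorem mainTheorem6 (G : GrPPH.WDigraph) :
    (∀ n : ℕ, ∃ B : GrPPH.Barcode, GrPPH.IsBarcodeOf B (G.iteratedMedial n).grpph) ∧
      ∃ L : GrPPH.Barcode, Finite L.ι ∧
        ∀ B : ℕ → GrPPH.Barcode,
          (∀ n, GrPPH.IsBarcodeOf (B n) (G.iteratedMedial n).grpph) →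
            Tendsto (fun n => GrPPH.bottleneckDist (B n) L) atTop (𝓝 0) := by
  have hgrounded := fun n => (G.iteratedMedial n).isGrounded_grpph
  refine ⟨fun n => (hgrounded n).exists_isBarcodeOf, ?_⟩
  obtain ⟨c, hc, hweight⟩ := G.exists_weight_le
  have hsummable : Summable fun n : ℕ => c / 2 ^ n := by
    simpa only [div_eq_mul_inv, one_mul, inv_pow] using summable_geometric_two.mul_left c
  exact GrPPH.exists_barcode_tendsto_bottleneckDist hgrounded hsummable fun n =>
    GrPPH.WDigraph.rankInterleaved_grpph_medial (by positivity)
      (GrPPH.WDigraph.iteratedMedial_weight_le hweight n)
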